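/- For integers $g$ and $r$, let $G(g,r)$ be the family of all (nonempty) finite simple $r$-regular graphs $G=(V,E)$ with girth at least $g$, the girth being the length of a shortest cycle. Let $W$ be a non-negative real random variable with distribution function $F(x)=\mathbb P(W\le x)$, density $f$, and $\mathbb E[W]<\infty$. Equip the edges of a graph $G$ with i.i.d. weights distributed as $W$, and let $\mathcal{MG}$ be the matching produced by GREEDY: repeatedly select the remaining edge of greatest weight (almost surely unique), add it to the matching, delete it and all remaining edges sharing an endpoint with it, and continue until no edge remains. Let $W[\mathcal{MG}]$ be the sum of the weights of the edges of $\mathcal{MG}$. Then for every $r\ge 3$, $$\lim_{g\to\infty}\ \inf_{G\in G(g,r)}\mathbb E\!\left[\frac{W[\mathcal{MG}]}{|V|}\right] =\lim_{g\to\infty}\ \sup_{G\in G(g,r)}\mathbb E\!\left[\frac{W[\mathcal{MG}]}{|V|}\right] =\frac r2\int_0^\infty x\,\bigl(r-1-(r-2)F(x)\bigr)^{-\frac{2(r-1)}{r-2}}f(x)\,dx .$$ Here the families $G(g,r)$ are nonempty for all $g$, all the expectations exist and are, for each $g$, uniformly bounded over $G(g,r)$, and the integral on the right is finite. -/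

import Mathlib

open MeasureTheory Filter Topology

/-- `G(g, r)`: the `r`-regular graphs on the vertex set `V` with girth at least `g`. -/
def regularGirthFamily (V : Type) [Fintype V] (g r : ℕ) : Set (SimpleGraph V) :=
  {G | (∀ v : V, (G.neighborSet v).ncard = r) ∧ (g : ℕ∞) ≤ G.egirth}

namespace GreedyMatching

variable {V : Type} {G : SimpleGraph V}

/-- Two edges are incident if they share an endpoint; an edge is incident to itself. -/
def Incident (e e' : G.edgeSet) : Prop :=
  ∃ v : V, v ∈ (e : Sym2 V) ∧ v ∈ (e' : Sym2 V)

theorem incident_refl (e : G.edgeSet) : Incident e e :=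
  ⟨(e : Sym2 V).out.1, Sym2.out_fst_mem _, Sym2.out_fst_mem _⟩

/-- An edge of greatest weight in a nonempty set of edges (ties are broken arbitrarily). -/
noncomputable def heaviest (w : G.edgeSet → ℝ) (S : Finset G.edgeSet) (h : S.Nonempty) :
    G.edgeSet :=
  (S.exists_max_image w h).choose

theorem heaviest_mem (w : G.edgeSet → ℝ) (S : Finset G.edgeSet) (h : S.Nonempty) :
    heaviest w S h ∈ S :=
  (S.exists_max_image w h).choose_spec.1

theorem le_heaviest (w : G.edgeSet → ℝ) (S : Finset G.edgeSet) (h : S.Nonempty) :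
    ∀ e ∈ S, w e ≤ w (heaviest w S h) :=
  (S.exists_max_image w h).choose_spec.2

open Classical in
/-- GREEDY run on the set `S` of remaining edges: select a heaviest remaining edge, delete it and
all remaining edges incident to it, and repeat until no edge remains. -/
noncomputable def run (w : G.edgeSet → ℝ) (S : Finset G.edgeSet) : Finset G.edgeSet :=
  if h : S.Nonempty then
    insert (heaviest w S h) (run w (S.filter fun e => ¬ Incident (heaviest w S h) e))
  else ∅
termination_by S.card
decreasing_by
  exact Finset.card_lt_card (Finset.filter_ssubset.2
    ⟨heaviest w S h, heaviest_mem w S h, fun hn => hn (incident_refl _)⟩)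

open Classical in
/-- The weight of the matching that GREEDY returns on the graph `G` with edge weights `w`. -/
noncomputable def weight [Fintype V] (G : SimpleGraph V) (w : G.edgeSet → ℝ) : ℝ :=
  ∑ e ∈ run w (Finset.univ : Finset G.edgeSet), w e

open Classical in
/-- The joint law of i.i.d. edge weights with common law `μ`. -/
noncomputable def weightLaw [Fintype V] (G : SimpleGraph V) (μ : Measure ℝ) :
    Measure (G.edgeSet → ℝ) :=
  Measure.pi fun _ : G.edgeSet => μ

/-- The expected weight per node of the matching that GREEDY returns on `G` when the edge weights
are i.i.d. with law `μ`. -/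
noncomputable def expectedRatio [Fintype V] (G : SimpleGraph V) (μ : Measure ℝ) : ℝ :=
  ∫ w, weight G w / (Fintype.card V : ℝ) ∂(weightLaw G μ)

/-- The values of `expectedRatio` over all nonempty finite graphs in `G(g, r)`. -/
def ratios (g r : ℕ) (μ : Measure ℝ) : Set ℝ :=
  {x | ∃ (V : Type) (_ : Fintype V) (_ : Nonempty V) (G : SimpleGraph V),
    G ∈ regularGirthFamily V g r ∧ x = expectedRatio G μ}

end GreedyMatching

/-! An edge is selected by GREEDY exactly when no heavier selected edge meets it. Whether the end
`v` of an edge `uv` is untouched by selected edges heavier than `uv` therefore obeys an outward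
recursion: `v` is free iff, for every heavier edge `vc`, the far end `c` is not free relative to
`vc` (`IsGreedy.isFree_iff`). Cutting this recursion at depth `n` with the value 1 gives
`freeApprox`. Since the recursion is decreasing in its inputs, even depths bound the truth from
above and odd depths from below (`IsGreedy.isFree_le_freeApprox`).

The truncation looks only at edges near `v`. If the girth is large compared with `n`, these form a
tree, the weights on different branches are independent, and the expectation is exactly `freeProb m
n (F x)` with `m = r - 1` (`integral_freeApprox`). On the quantile scale `t = F x` these are the
Picard iterates of `H t = (1 - ∫ s in t..1, H s) ^ m`, whose solution is `H t = (m - (m - 1) t) ^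
(-m / (m - 1))`, and they converge to it (`tendsto_freeProb`).

Given the weight of an edge, the truncated indicators at its two ends are independent, which
produces the square `H ^ 2`. So each edge contributes `∫ x H(F x)² f(x) dx` up to an error governed
by the depth alone, and there are `r / 2` edges per vertex. The bounds do not depend on the graph,
so infimum and supremum have the same limit. Cayley graphs of permutation groups show that the
families are nonempty. -/

/-! ### Regular graphs of large girth as Cayley graphs -/

/-- The words over `Fin r` of length at most `L` without two equal consecutive letters: the ball of
radius `L` in the `r`-regular tree. -/
abbrev ReducedWord (r L : ℕ) : Type :=
  {l : List (Fin r) // l.IsChain (· ≠ ·) ∧ l.length ≤ L}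

namespace ReducedWord

variable {r L : ℕ}

instance : Finite (ReducedWord r L) :=
  ((List.finite_length_le (Fin r) L).subset fun _ h => h.2).to_subtype

/-- Removes the first letter of the word if it is `i`, otherwise puts `i` in front if there is room
for it. -/
def toggle (i : Fin r) (x : ReducedWord r L) : ReducedWord r L :=
  if h : x.1.head? = some i then
    ⟨x.1.tail, x.2.1.tail, by simpa using Nat.le_succ_of_le x.2.2⟩
  else if hl : x.1.length < L then
    ⟨i :: x.1, by
      refine List.isChain_cons.2 ⟨fun y hy hiy => h ?_, x.2.1⟩
      rw [hiy]; exact hy, hl⟩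
  else x

/-- Deleting and prepending `i` undo each other: after a deletion the word does not start with `i`,
being reduced, and there is room again. Full words not starting with `i` are fixed. -/
theorem toggle_involutive (i : Fin r) : Function.Involutive (toggle (L := L) i) := by
  rintro ⟨l, hc, hl⟩
  rcases l with _ | ⟨a, t⟩
  · unfold toggle
    by_cases h : 0 < L <;> simp [h]
  · by_cases ha : a = i
    · subst ha
      have ht : ¬ t.head? = some a := fun h => (List.isChain_cons.1 hc).1 a h rfl
      have hl' : t.length < L := hl
      unfold toggle
      simp [ht, hl']
    · unfold toggle
      by_cases h : t.length + 1 < L <;> simp [h, ha]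

/-- `toggle` as a permutation. -/
def togglePerm (i : Fin r) : Equiv.Perm (ReducedWord r L) :=
  (toggle_involutive i).toPerm

/-- The empty word. -/
def empty : ReducedWord r L := ⟨[], List.isChain_nil, Nat.zero_le _⟩

theorem togglePerm_mul_self (i : Fin r) : togglePerm (L := L) i * togglePerm i = 1 := by
  ext x : 1
  exact toggle_involutive i x

/-- A reduced word writes itself, from its last letter to its first, onto the empty word. Hence no
nonempty reduced word of length at most `L` acts trivially. -/
theorem prod_togglePerm_empty (l : List (Fin r)) (hc : l.IsChain (· ≠ ·)) (hl : l.length ≤ L) :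
    (l.map togglePerm).prod (empty : ReducedWord r L) = ⟨l, hc, hl⟩ := by
  induction l with
  | nil => rfl
  | cons i t ih =>
    have ht : ¬ t.head? = some i := fun h => (List.isChain_cons.1 hc).1 i h rfl
    have hl' : t.length < L := hl
    rw [List.map_cons, List.prod_cons, Equiv.Perm.mul_apply, ih hc.tail hl'.le]
    change toggle _ _ = _
    unfold toggle
    simp [ht, hl']

theorem togglePerm_injective (hL : 1 ≤ L) :
    Function.Injective (togglePerm : Fin r → Equiv.Perm (ReducedWord r L)) := by
  intro i j h
  have hi := prod_togglePerm_empty (L := L) [i] (by simp) hL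
  have hj := prod_togglePerm_empty (L := L) [j] (by simp) hL
  simp only [List.map_cons, List.map_nil, List.prod_cons, List.prod_nil, mul_one] at hi hj
  rw [h, hj] at hi
  simpa using (congrArg Subtype.val hi).symm

/-- The Cayley graph generated by the permutations `togglePerm i`. -/
def cayleyGraph (r L : ℕ) (hL : 1 ≤ L) : SimpleGraph (Equiv.Perm (ReducedWord r L)) where
  Adj a b := ∃ i, b = togglePerm i * a
  symm.symm := by
    rintro a b ⟨i, rfl⟩
    exact ⟨i, by rw [← mul_assoc, togglePerm_mul_self, one_mul]⟩
  loopless.irrefl := by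
    rintro a ⟨i, h⟩
    have h1 : togglePerm (L := L) i = 1 := by simpa using h.symm
    have hi := prod_togglePerm_empty (L := L) [i] (by simp) hL
    simp only [List.map_cons, List.map_nil, List.prod_cons, List.prod_nil, mul_one, h1] at hi
    exact absurd (congrArg Subtype.val hi) (by simp [empty])

/-- The last clause carries the induction: the first letter determines the first edge, so a repeated
letter would mean a repeated edge. -/
theorem exists_word_of_walk (hL : 1 ≤ L) {a b : Equiv.Perm (ReducedWord r L)}
    (p : (cayleyGraph r L hL).Walk a b) (hp : p.edges.IsChain (· ≠ ·)) :
    ∃ l : List (Fin r), l.IsChain (· ≠ ·) ∧ l.length = p.length ∧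
      a = (l.map togglePerm).prod * b ∧
      ∀ i ∈ l.head?, p.edges.head? = some s(a, togglePerm i * a) := by
  induction p with
  | nil => exact ⟨[], by simp⟩
  | @cons a c b h q ih =>
    rw [SimpleGraph.Walk.edges_cons] at hp
    obtain ⟨l, hl, hlen, hprod, hhead⟩ := ih hp.tail
    obtain ⟨i, hi⟩ := id h
    have hi' : a = togglePerm i * c := by
      rw [hi, ← mul_assoc, togglePerm_mul_self, one_mul]
    refine ⟨i :: l, List.isChain_cons.2 ⟨fun j hj hij => ?_, hl⟩, by simp [hlen], ?_, ?_⟩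
    · refine (List.isChain_cons.1 hp).1 _ (hhead j hj) ?_
      rw [← hij, ← hi', Sym2.eq_swap]
    · rw [List.map_cons, List.prod_cons, mul_assoc, ← hprod, hi']
    · intro j hj
      obtain rfl : i = j := by simpa using hj
      simp [hi]

/-- A cycle shorter than `L` would spell a nonempty reduced word with trivial product, which the
action on the empty word excludes. -/
theorem cayleyGraph_mem_regularGirthFamily (hL : 1 ≤ L) [Fintype (Equiv.Perm (ReducedWord r L))] :
    cayleyGraph r L hL ∈ regularGirthFamily (Equiv.Perm (ReducedWord r L)) L r := by
  refine ⟨fun a => ?_, SimpleGraph.le_egirth.2 fun a p hp => ?_⟩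
  · have : (cayleyGraph r L hL).neighborSet a = Set.range fun i => togglePerm i * a := by
      ext b
      exact ⟨fun ⟨i, hi⟩ => ⟨i, hi.symm⟩, fun ⟨i, hi⟩ => ⟨i, hi.symm⟩⟩
    rw [this]
    have hinj := (mul_left_injective a).comp (togglePerm_injective (r := r) hL)
    exact (Set.ncard_range_of_injective hinj).trans (by simp)
  · by_contra! hlt
    have hlt' : p.length < L := by exact_mod_cast hlt
    obtain ⟨l, hl, hlen, hprod, -⟩ := exists_word_of_walk hL p
      (List.Pairwise.isChain hp.isTrail.edges_nodup)
    have h1 : (l.map (togglePerm (L := L))).prod = 1 := by simpa using hprod.symm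
    have := prod_togglePerm_empty l hl (hlen.trans_lt hlt').le
    rw [h1] at this
    have h0 : l = [] := (congrArg Subtype.val this).symm
    have := hp.three_le_length
    simp [h0] at hlen
    omega

end ReducedWord

/-- There are `r`-regular finite graphs of arbitrarily large girth. -/
theorem exists_mem_regularGirthFamily (g r : ℕ) :
    ∃ (V : Type) (_ : Fintype V) (_ : Nonempty V) (G : SimpleGraph V),
      G ∈ regularGirthFamily V g r := by
  classical
  -- Radius `g + 1` keeps `1 ≤ L` also for `g = 0`; distinctness of the generators needs this.
  have : Fintype (Equiv.Perm (ReducedWord r (g + 1))) := Fintype.ofFinite _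
  have h := ReducedWord.cayleyGraph_mem_regularGirthFamily (r := r) (L := g + 1) (by omega)
  exact ⟨_, this, inferInstance, _, h.1, le_trans (by exact_mod_cast Nat.le_succ g) h.2⟩

/-! ### Non-backtracking walks and disjoint branches below the girth -/

namespace SimpleGraph

variable {V : Type*} {G : SimpleGraph V}

/-- A subgraph spanned by fewer edges than the girth is acyclic. -/
theorem isAcyclic_fromEdgeSet_of_length_lt_egirth (l : List (Sym2 V))
    (hl : ∀ e ∈ l, e ∈ G.edgeSet) (hlen : (l.length : ℕ∞) < G.egirth) :
    (fromEdgeSet {e | e ∈ l}).IsAcyclic := by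
  intro a c hc
  have hle : fromEdgeSet {e | e ∈ l} ≤ G := by
    intro x y hxy
    exact hl _ ((fromEdgeSet_adj _).1 hxy).1
  have h1 := (hc.mapLe hle).isCircuit.egirth_le_length
  rw [Walk.length_map] at h1
  have h2 : c.length ≤ l.length := by
    rw [← Walk.length_edges]
    refine List.Subperm.length_le (hc.isTrail.edges_nodup.subperm fun e he => ?_)
    have := c.edges_subset_edgeSet he
    rw [edgeSet_fromEdgeSet] at this
    exact this.1
  exact absurd (h1.trans (by exact_mod_cast h2)) (not_le.2 hlen)

/-- Short non-backtracking walks are determined by their endpoints. -/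
theorem Walk.eq_of_isChain_edges {u v : V} (p q : G.Walk u v) (hp : p.edges.IsChain (· ≠ ·))
    (hq : q.edges.IsChain (· ≠ ·)) (hlen : ((p.length + q.length : ℕ) : ℕ∞) < G.egirth) :
    p = q := by
  have hac := isAcyclic_fromEdgeSet_of_length_lt_egirth (G := G) (p.edges ++ q.edges)
    (by
      intro e he
      rcases List.mem_append.1 he with h | h
      exacts [p.edges_subset_edgeSet h, q.edges_subset_edgeSet h]) (by simpa using hlen)
  have hmem : ∀ e ∈ p.edges ++ q.edges,
      e ∈ (fromEdgeSet {e | e ∈ p.edges ++ q.edges}).edgeSet := by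
    intro e he
    rw [edgeSet_fromEdgeSet]
    refine ⟨he, fun hd => ?_⟩
    rcases List.mem_append.1 he with h | h
    exacts [G.not_isDiag_of_mem_edgeSet (p.edges_subset_edgeSet h) hd,
      G.not_isDiag_of_mem_edgeSet (q.edges_subset_edgeSet h) hd]
  have hpm := fun e he => hmem e (List.mem_append_left _ he)
  have hqm := fun e he => hmem e (List.mem_append_right _ he)
  -- Both walks live in the forest spanned by their edges, where a walk without equal consecutive
  -- edges is a path and its endpoints determine it.
  have hp' := (hac.isPath_iff_isChain (p.transfer _ hpm)).2 (by rwa [edges_transfer])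
  have hq' := (hac.isPath_iff_isChain (q.transfer _ hqm)).2 (by rwa [edges_transfer])
  have := hac.subsingleton_path u v
  have h := congrArg Subtype.val (Subsingleton.elim (⟨_, hp'⟩ : Path _ u v) ⟨_, hq'⟩)
  refine ext_support ?_
  rw [← p.support_transfer hpm, ← q.support_transfer hqm]
  exact congrArg support h

/-- The edges of `G` that are reached from `v` by a non-backtracking walk of length at most `n + 1`
whose first step goes to `c`. -/
def branch (G : SimpleGraph V) : ℕ → V → V → Set (Sym2 V)
  | 0, v, c => {s(v, c)}
  | n + 1, v, c => {s(v, c)} ∪ ⋃ d ∈ {d | G.Adj c d ∧ d ≠ v}, branch G n c d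

theorem mk_mem_branch (n : ℕ) (v c : V) : s(v, c) ∈ G.branch n v c := by
  cases n <;> simp [branch]

theorem branch_subset_succ (n : ℕ) (v c : V) : G.branch n v c ⊆ G.branch (n + 1) v c := by
  induction n generalizing v c with
  | zero => exact Set.subset_union_left
  | succ n ih =>
    exact Set.union_subset_union_right _ (Set.iUnion₂_mono fun d _ => ih c d)

theorem exists_walk_of_mem_branch {n : ℕ} {v c : V} (h : G.Adj v c) {e : Sym2 V}
    (he : e ∈ G.branch n v c) :
    ∃ (x y : V) (p : G.Walk v x) (hxy : G.Adj x y), e = s(x, y) ∧ p.length ≤ n ∧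
      (p.concat hxy).edges.IsChain (· ≠ ·) ∧ (p.concat hxy).edges.head? = some s(v, c) := by
  induction n generalizing v c with
  | zero =>
    obtain rfl : e = s(v, c) := by simpa [branch] using he
    exact ⟨v, c, .nil, h, rfl, by simp, by simp [Walk.concat], by simp [Walk.concat]⟩
  | succ n ih =>
    rcases he with he | he
    · obtain rfl : e = s(v, c) := by simpa using he
      exact ⟨v, c, .nil, h, rfl, by simp, by simp [Walk.concat], by simp [Walk.concat]⟩
    · simp only [Set.mem_iUnion, Set.mem_ofPred_eq] at he
      obtain ⟨d, ⟨hcd, hdv⟩, he⟩ := he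
      obtain ⟨x, y, p, hxy, rfl, hlen, hchain, hhead⟩ := ih hcd he
      refine ⟨x, y, .cons h p, hxy, rfl, by simpa using hlen, ?_, by simp [Walk.concat_cons]⟩
      rw [Walk.concat_cons, Walk.edges_cons]
      refine List.isChain_cons.2 ⟨fun e he heq => hdv ?_, hchain⟩
      rw [hhead] at he
      obtain rfl : s(c, d) = e := by simpa using he
      simp at heq
      rcases heq with ⟨h1, -⟩ | h1
      · exact absurd h1 h.ne
      · exact h1.symm

/-- A common edge would end two non-backtracking walks from `v` of length at most `n + 1` with
different first edges. If they traverse it in the same direction, they coincide by shortness. If in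
opposite directions, the first walk without its last edge equals the second, so the first walk runs
through the edge twice in succession. -/
theorem disjoint_branch {n : ℕ} (hg : ((2 * n + 2 : ℕ) : ℕ∞) < G.egirth) {v c c' : V}
    (h : G.Adj v c) (h' : G.Adj v c') (hcc : c ≠ c') :
    Disjoint (G.branch n v c) (G.branch n v c') := by
  refine Set.disjoint_left.2 fun e he he' => ?_
  obtain ⟨x, y, p, hxy, rfl, hlen, hchain, hhead⟩ := exists_walk_of_mem_branch h he
  obtain ⟨x', y', q, hxy', heq, hlen', hchain', hhead'⟩ := exists_walk_of_mem_branch h' he'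
  have hne : s(v, c) ≠ s(v, c') := by
    intro h0
    simp at h0
    rcases h0 with h0 | h0
    exacts [hcc h0, hcc (h0.2.trans h0.1)]
  have hshort {m : ℕ} (hm : m ≤ 2 * n + 2) : (m : ℕ∞) < G.egirth :=
    lt_of_le_of_lt (by exact_mod_cast hm) hg
  have hinit {z w : V} (p : G.Walk v z) (hzw : G.Adj z w)
      (hc : (p.concat hzw).edges.IsChain (· ≠ ·)) : p.edges.IsChain (· ≠ ·) := by
    rw [Walk.edges_concat, List.concat_eq_append] at hc
    exact hc.left_of_append
  rcases Sym2.eq_iff.1 heq with ⟨rfl, rfl⟩ | ⟨rfl, rfl⟩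
  · have := Walk.eq_of_isChain_edges (p.concat hxy) (q.concat hxy') hchain hchain'
      (hshort (by simp only [Walk.length_concat]; omega))
    rw [this, hhead'] at hhead
    exact hne (Option.some_injective _ hhead).symm
  · have := Walk.eq_of_isChain_edges p (q.concat hxy') (hinit _ _ hchain) hchain'
      (hshort (by simp only [Walk.length_concat]; omega))
    rw [this, Walk.edges_concat, Walk.edges_concat, List.concat_eq_append,
      List.concat_eq_append, List.append_assoc] at hchain
    have h2 := hchain.right_of_append
    simp [Sym2.eq_swap] at h2

/-- Seen from `c`, the edge to `v` lies in the branch towards `v`, which is disjoint from the one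
towards `d`. -/
theorem notMem_branch {n : ℕ} (hg : ((2 * n + 2 : ℕ) : ℕ∞) < G.egirth) {v c d : V}
    (h : G.Adj v c) (hd : G.Adj c d) (hdv : d ≠ v) : s(v, c) ∉ G.branch n c d := by
  intro hmem
  exact Set.disjoint_left.1 (disjoint_branch hg hd h.symm hdv) hmem
    (Sym2.eq_swap ▸ mk_mem_branch n c v)

end SimpleGraph

/-! ### GREEDY as the solution of a local recursion -/

namespace GreedyMatching

variable {V : Type} {G : SimpleGraph V}

theorem run_subset (w : G.edgeSet → ℝ) (S : Finset G.edgeSet) : run w S ⊆ S := by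
  classical
  induction S using Finset.strongInduction with
  | H S ih =>
    rw [run]
    split_ifs with h
    · have hmem := heaviest_mem w S h
      refine Finset.insert_subset hmem ((ih _ ?_).trans (Finset.filter_subset _ _))
      exact Finset.filter_ssubset.2 ⟨_, hmem, fun hn => hn (incident_refl _)⟩
    · simp

/-- GREEDY selects exactly those edges that no heavier selected edge is incident to. -/
theorem mem_run_iff {w : G.edgeSet → ℝ} (hw : Function.Injective w) (S : Finset G.edgeSet) :
    ∀ e ∈ S, (e ∈ run w S ↔ ∀ e' ∈ run w S, Incident e' e → ¬ w e < w e') := by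
  classical
  induction S using Finset.strongInduction with
  | H S ih =>
    intro e he
    have h : S.Nonempty := ⟨e, he⟩
    set m := heaviest w S h with hm
    set S' := S.filter fun e => ¬ Incident m e with hS'
    have hrun : run w S = insert m (run w S') := by rw [run, dif_pos h]
    have hmS : m ∈ S := heaviest_mem w S h
    have hmax : ∀ e ∈ S, w e ≤ w m := le_heaviest w S h
    have hss : S' ⊂ S := Finset.filter_ssubset.2 ⟨m, hmS, fun hn => hn (incident_refl _)⟩
    by_cases hem : e = m
    · refine iff_of_true (by rw [hrun, hem]; exact Finset.mem_insert_self _ _) fun e' he' _ => ?_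
      rw [hem]
      exact not_lt.2 (hmax e' (run_subset w S he'))
    by_cases hinc : Incident m e
    · refine iff_of_false (fun h1 => ?_) fun h1 => ?_
      · rw [hrun] at h1
        have h2 := run_subset w S' ((Finset.mem_insert.1 h1).resolve_left hem)
        exact (Finset.mem_filter.1 h2).2 hinc
      · refine h1 m (by rw [hrun]; exact Finset.mem_insert_self _ _) hinc ?_
        -- Injectivity of the weights is what makes `m` strictly heavier than the edges it deletes.
        exact lt_of_le_of_ne (hmax e he) (hw.ne hem)
    · have heS' : e ∈ S' := Finset.mem_filter.2 ⟨he, hinc⟩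
      rw [hrun]
      simp only [Finset.mem_insert, forall_eq_or_imp, hem, false_or]
      rw [ih S' hss e heS']
      exact ⟨fun h1 => ⟨fun h2 => absurd h2 hinc, h1⟩, fun h1 => h1.2⟩

/-- Edge weights extended by zero to all pairs of vertices. -/
noncomputable def extendWeights (w : G.edgeSet → ℝ) (e : Sym2 V) : ℝ :=
  open Classical in if h : e ∈ G.edgeSet then w ⟨e, h⟩ else 0

theorem extendWeights_coe (w : G.edgeSet → ℝ) (e : G.edgeSet) : extendWeights w e = w e := by
  simp [extendWeights]

theorem extendWeights_of_mem (w : G.edgeSet → ℝ) {e : Sym2 V} (h : e ∈ G.edgeSet) :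
    extendWeights w e = w ⟨e, h⟩ := by
  simp [extendWeights, h]

/-- No edge of `M` at `v` is heavier than the edge from `u` to `v`. -/
def IsFree (G : SimpleGraph V) (M : Set (Sym2 V)) (w : Sym2 V → ℝ) (u v : V) : Prop :=
  ∀ c, G.Adj v c → w s(u, v) < w s(v, c) → s(v, c) ∉ M

/-- `M` consists of the edges whose two endpoints are free. -/
def IsGreedy (G : SimpleGraph V) (M : Set (Sym2 V)) (w : Sym2 V → ℝ) : Prop :=
  ∀ ⦃u v⦄, G.Adj u v → (s(u, v) ∈ M ↔ IsFree G M w u v ∧ IsFree G M w v u)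

theorem isGreedy_run [Fintype G.edgeSet] {w : G.edgeSet → ℝ} (hw : Function.Injective w) :
    IsGreedy G (Subtype.val '' (run w Finset.univ : Set G.edgeSet)) (extendWeights w) := by
  intro u v huv
  have hmem {e : Sym2 V} (he : e ∈ G.edgeSet) :
      e ∈ Subtype.val '' (run w Finset.univ : Set G.edgeSet) ↔ ⟨e, he⟩ ∈ run w Finset.univ := by
    simp [he]
  rw [hmem huv, mem_run_iff hw _ _ (Finset.mem_univ _)]
  constructor
  · intro h
    refine ⟨fun c hc hlt hM => ?_, fun c hc hlt hM => ?_⟩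
    · refine h _ ((hmem (G.mem_edgeSet.2 hc)).1 hM) ⟨v, by simp, by simp⟩ ?_
      rwa [extendWeights_of_mem w (G.mem_edgeSet.2 huv),
        extendWeights_of_mem w (G.mem_edgeSet.2 hc)] at hlt
    · rw [Sym2.eq_swap] at hlt
      refine h _ ((hmem (G.mem_edgeSet.2 hc)).1 hM) ⟨u, by simp, by simp⟩ ?_
      rwa [extendWeights_of_mem w (G.mem_edgeSet.2 huv),
        extendWeights_of_mem w (G.mem_edgeSet.2 hc)] at hlt
  · rintro ⟨h1, h2⟩ ⟨e, he⟩ hrun ⟨x, hx1, hx2⟩ hlt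
    rw [← extendWeights_coe w, ← extendWeights_coe w] at hlt
    obtain ⟨c, rfl⟩ := Sym2.mem_iff_exists.1 hx1
    rcases Sym2.mem_iff.1 hx2 with rfl | rfl
    · exact h2 c he (by rwa [Sym2.eq_swap]) ((hmem he).2 hrun)
    · exact h1 c he hlt ((hmem he).2 hrun)

/-- Selection requires both ends to be free, but the far end suffices here: among the heavier edges
at `v` with free far end, the heaviest is also free at `v`, hence selected. So freeness is expressed
through freeness further out, without mentioning `M`. -/
theorem IsGreedy.isFree_iff [Finite V] {M : Set (Sym2 V)} {w : Sym2 V → ℝ} (hM : IsGreedy G M w)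
    (u v : V) : IsFree G M w u v ↔ ∀ c, G.Adj v c → w s(u, v) < w s(v, c) → ¬ IsFree G M w v c := by
  constructor
  · intro h c hc hlt hfree
    obtain ⟨m, ⟨hm, hmlt, hmfree⟩, hmax⟩ := Set.exists_max_image
      {c | G.Adj v c ∧ w s(u, v) < w s(v, c) ∧ IsFree G M w v c} (fun c => w s(v, c))
      (Set.toFinite _) ⟨c, hc, hlt, hfree⟩
    refine h m hm hmlt ((hM hm).2 ⟨hmfree, fun d hd hdlt hdM => ?_⟩)
    rw [Sym2.eq_swap] at hdlt
    exact not_lt.2 (hmax d ⟨hd, hmlt.trans hdlt, ((hM hd).1 hdM).1⟩) hdlt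
  · intro h c hc hlt hcM
    exact h c hc hlt ((hM hc).1 hcM).1

open Classical in
/-- The indicator of the event that GREEDY, run on the walks of length at most `n` that start at
`v`, do not step back to `u` first, and have increasing weights above `x`, leaves `v` free. -/
noncomputable def freeApprox [Fintype V] (G : SimpleGraph V) (w : Sym2 V → ℝ) :
    ℕ → V → V → ℝ → ℝ
  | 0, _, _, _ => 1
  | n + 1, u, v, x => ∏ c ∈ (G.neighborFinset v).erase u,
      (1 - if x < w s(v, c) then freeApprox G w n v c (w s(v, c)) else 0)

section

variable [Fintype V] {w : Sym2 V → ℝ}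

theorem freeApprox_mem_Icc (n : ℕ) (u v : V) (x : ℝ) :
    freeApprox G w n u v x ∈ Set.Icc (0 : ℝ) 1 := by
  classical
  induction n generalizing u v x with
  | zero => simp [freeApprox]
  | succ n ih =>
    have h : ∀ c, (1 - if x < w s(v, c) then freeApprox G w n v c (w s(v, c)) else 0) ∈
        Set.Icc (0 : ℝ) 1 := by
      intro c
      have := ih v c (w s(v, c))
      rw [Set.mem_Icc] at this ⊢
      split_ifs <;> constructor <;> linarith
    exact ⟨Finset.prod_nonneg fun c _ => (h c).1,
      Finset.prod_le_one (fun c _ => (h c).1) fun c _ => (h c).2⟩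

-- Leaving out `u` costs nothing: the edge back to `u` is not strictly heavier than itself.
open Classical in
theorem IsGreedy.ite_isFree_eq_prod {M : Set (Sym2 V)} (hM : IsGreedy G M w) (u v : V) :
    (if IsFree G M w u v then (1 : ℝ) else 0) = ∏ c ∈ (G.neighborFinset v).erase u,
      (1 - if w s(u, v) < w s(v, c) then (if IsFree G M w v c then (1 : ℝ) else 0) else 0) := by
  by_cases h : IsFree G M w u v
  · rw [if_pos h, Finset.prod_eq_one]
    intro c hc
    have hc' : G.Adj v c := by simpa using (Finset.mem_erase.1 hc).2
    have := (hM.isFree_iff u v).1 h c hc'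
    split_ifs with h1 h2
    · exact absurd h2 (this h1)
    · simp
    · simp
  · rw [if_neg h]
    rw [hM.isFree_iff] at h
    push Not at h
    obtain ⟨c, hc, hlt, hfree⟩ := h
    refine (Finset.prod_eq_zero (i := c) (Finset.mem_erase.2 ⟨?_, by simpa using hc⟩) ?_).symm
    · rintro rfl
      rw [Sym2.eq_swap] at hlt
      exact hlt.false
    · simp [hlt, hfree]

-- The product is decreasing in the values at the next level, and the starting value 1 is an upper
-- bound, so the truncations alternate around the truth.
open Classical in
theorem IsGreedy.isFree_le_freeApprox {M : Set (Sym2 V)} (hM : IsGreedy G M w) (k : ℕ) : ∀ u v : V,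
    (if IsFree G M w u v then (1 : ℝ) else 0) ≤ freeApprox G w (2 * k) u v (w s(u, v)) ∧
    freeApprox G w (2 * k + 1) u v (w s(u, v)) ≤ if IsFree G M w u v then (1 : ℝ) else 0 := by
  have hmem : ∀ u v : V, (if IsFree G M w u v then (1 : ℝ) else 0) ∈ Set.Icc (0 : ℝ) 1 := by
    intro u v
    split_ifs <;> simp
  have hanti {a b : V → ℝ} (u v : V) (hab : ∀ c, a c ≤ b c) (hb : ∀ c, b c ≤ 1) :
      ∏ c ∈ (G.neighborFinset v).erase u, (1 - if w s(u, v) < w s(v, c) then b c else 0) ≤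
      ∏ c ∈ (G.neighborFinset v).erase u, (1 - if w s(u, v) < w s(v, c) then a c else 0) := by
    refine Finset.prod_le_prod (fun c _ => ?_) fun c _ => ?_
    · have := hb c
      split_ifs <;> linarith
    · have := hab c
      split_ifs <;> linarith
  have hodd : ∀ n, (∀ u v : V, (if IsFree G M w u v then (1 : ℝ) else 0) ≤
      freeApprox G w n u v (w s(u, v))) → ∀ u v : V,
      freeApprox G w (n + 1) u v (w s(u, v)) ≤ if IsFree G M w u v then (1 : ℝ) else 0 := by
    intro n hn u v
    rw [hM.ite_isFree_eq_prod]
    exact hanti u v (fun c => hn v c) fun c => (freeApprox_mem_Icc n _ _ _).2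
  have heven : ∀ n, (∀ u v : V, freeApprox G w n u v (w s(u, v)) ≤
      if IsFree G M w u v then (1 : ℝ) else 0) → ∀ u v : V,
      (if IsFree G M w u v then (1 : ℝ) else 0) ≤ freeApprox G w (n + 1) u v (w s(u, v)) := by
    intro n hn u v
    rw [hM.ite_isFree_eq_prod]
    exact hanti u v (fun c => hn v c) fun c => (hmem _ _).2
  have key : ∀ k, ∀ u v : V, (if IsFree G M w u v then (1 : ℝ) else 0) ≤
      freeApprox G w (2 * k) u v (w s(u, v)) := by
    intro k
    induction k with
    | zero => exact fun u v => (hmem u v).2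
    | succ k ih => exact heven _ (hodd _ ih)
  exact fun u v => ⟨key k u v, hodd _ (key k) u v⟩

-- Weights strictly increase along the recursion, so it stops by itself once the depth exceeds the
-- number of heavier edges.
open Classical in
theorem IsGreedy.freeApprox_eq {M : Set (Sym2 V)} (hM : IsGreedy G M w) (n : ℕ) {u v : V}
    (hn : (G.edgeFinset.filter fun e => w s(u, v) < w e).card < n) :
    freeApprox G w n u v (w s(u, v)) = if IsFree G M w u v then (1 : ℝ) else 0 := by
  induction n generalizing u v with
  | zero => omega
  | succ n ih =>
    rw [hM.ite_isFree_eq_prod, freeApprox]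
    refine Finset.prod_congr rfl fun c hc => ?_
    have hc' : G.Adj v c := by simpa using (Finset.mem_erase.1 hc).2
    by_cases hlt : w s(u, v) < w s(v, c)
    · rw [if_pos hlt, if_pos hlt, ih]
      refine lt_of_lt_of_le (Finset.card_lt_card ?_) (Nat.le_of_lt_succ hn)
      refine Finset.ssubset_iff_subset_ne.2 ⟨fun e he => ?_, fun heq => ?_⟩
      · rw [Finset.mem_filter] at he ⊢
        exact ⟨he.1, hlt.trans he.2⟩
      · have : s(v, c) ∈ G.edgeFinset.filter fun e => w s(u, v) < w e :=
          Finset.mem_filter.2 ⟨by simpa using hc', hlt⟩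
        rw [← heq, Finset.mem_filter] at this
        exact this.2.false
    · rw [if_neg hlt, if_neg hlt]

end

end GreedyMatching

/-! ### The recursion on the `m`-ary tree and its limit -/

namespace GreedyMatching

/-- The probability that the root of an `m`-ary tree of depth `n` is left free by the edges of
weight above the `t`-quantile. -/
noncomputable def freeProb (m : ℕ) : ℕ → ℝ → ℝ
  | 0, _ => 1
  | n + 1, t => (1 - ∫ s in t..1, freeProb m n s) ^ m

/-- The limit of `freeProb m n` as `n` tends to infinity. -/
noncomputable def freeProbLimit (m : ℕ) (t : ℝ) : ℝ :=
  ((m : ℝ) - ((m : ℝ) - 1) * t) ^ (-((m : ℝ) / ((m : ℝ) - 1)))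

theorem continuous_freeProb (m n : ℕ) : Continuous (freeProb m n) := by
  induction n with
  | zero => exact continuous_const
  | succ n ih =>
    have : Continuous fun t : ℝ => ∫ s in t..1, freeProb m n s := by
      simp_rw [fun t : ℝ => intervalIntegral.integral_symm (f := freeProb m n) (μ := volume) 1 t]
      exact (intervalIntegral.continuous_primitive (fun _ _ => ih.intervalIntegrable _ _) 1).neg
    exact (continuous_const.sub this).pow m

theorem intervalIntegral_mem_Icc {φ : ℝ → ℝ} {t : ℝ} (ht : t ∈ Set.Icc (0 : ℝ) 1)
    (hφ : ∀ s ∈ Set.Icc (0 : ℝ) 1, φ s ∈ Set.Icc (0 : ℝ) 1)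
    (hint : IntervalIntegrable φ volume t 1) :
    ∫ s in t..1, φ s ∈ Set.Icc (0 : ℝ) 1 := by
  have hsub : ∀ s ∈ Set.Icc t 1, φ s ∈ Set.Icc (0 : ℝ) 1 := fun s hs =>
    hφ s ⟨ht.1.trans hs.1, hs.2⟩
  refine ⟨intervalIntegral.integral_nonneg ht.2 fun s hs => (hsub s hs).1, ?_⟩
  have := intervalIntegral.integral_mono_on ht.2 hint
    (intervalIntegrable_const (c := (1 : ℝ))) fun s hs => (hsub s hs).2
  rw [intervalIntegral.integral_const, smul_eq_mul, mul_one] at this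
  linarith [ht.1]

theorem freeProb_mem_Icc (m n : ℕ) {t : ℝ} (ht : t ∈ Set.Icc (0 : ℝ) 1) :
    freeProb m n t ∈ Set.Icc (0 : ℝ) 1 := by
  induction n generalizing t with
  | zero => simp [freeProb]
  | succ n ih =>
    have h := intervalIntegral_mem_Icc ht (fun s hs => ih hs)
      ((continuous_freeProb m n).intervalIntegrable _ _)
    exact ⟨pow_nonneg (by linarith [h.2]) _, pow_le_one₀ (by linarith [h.2]) (by linarith [h.1])⟩

section

variable {m : ℕ}

theorem one_le_freeProbLimit_base (hm : 2 ≤ m) {t : ℝ} (ht : t ≤ 1) :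
    1 ≤ (m : ℝ) - ((m : ℝ) - 1) * t := by
  have : (2 : ℝ) ≤ m := by exact_mod_cast hm
  nlinarith

theorem freeProbLimit_mem_Icc (hm : 2 ≤ m) {t : ℝ} (ht : t ≤ 1) :
    freeProbLimit m t ∈ Set.Icc (0 : ℝ) 1 := by
  have hb := one_le_freeProbLimit_base hm ht
  have : (2 : ℝ) ≤ m := by exact_mod_cast hm
  refine ⟨Real.rpow_nonneg (by linarith) _, Real.rpow_le_one_of_one_le_of_nonpos hb ?_⟩
  rw [neg_nonpos]
  exact div_nonneg (by linarith) (by linarith)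

theorem continuousOn_freeProbLimit (hm : 2 ≤ m) :
    ContinuousOn (freeProbLimit m) (Set.Iic 1) := by
  refine ContinuousOn.rpow_const (by fun_prop) fun t ht => Or.inl ?_
  have := one_le_freeProbLimit_base hm ht
  linarith

theorem intervalIntegrable_freeProbLimit (hm : 2 ≤ m) {t : ℝ} (ht : t ≤ 1) :
    IntervalIntegrable (freeProbLimit m) volume t 1 := by
  refine ((continuousOn_freeProbLimit hm).mono ?_).intervalIntegrable
  rw [Set.uIcc_of_le ht]
  exact fun s hs => hs.2

theorem integral_freeProbLimit (hm : 2 ≤ m) {t : ℝ} (ht : t ≤ 1) :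
    ∫ s in t..1, freeProbLimit m s =
      1 - ((m : ℝ) - ((m : ℝ) - 1) * t) ^ (-(1 / ((m : ℝ) - 1))) := by
  have hm' : (2 : ℝ) ≤ m := by exact_mod_cast hm
  have hm1 : (m : ℝ) - 1 ≠ 0 := by linarith
  have hderiv : ∀ s ∈ Set.uIcc t 1, HasDerivAt
      (fun s : ℝ => ((m : ℝ) - ((m : ℝ) - 1) * s) ^ (-(1 / ((m : ℝ) - 1))))
      (freeProbLimit m s) s := by
    intro s hs
    rw [Set.uIcc_of_le ht] at hs
    have hb := one_le_freeProbLimit_base hm hs.2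
    have h1 : HasDerivAt (fun s : ℝ => (m : ℝ) - ((m : ℝ) - 1) * s) (-((m : ℝ) - 1)) s := by
      simpa using ((hasDerivAt_id s).const_mul ((m : ℝ) - 1)).const_sub (m : ℝ)
    convert h1.rpow_const (p := -(1 / ((m : ℝ) - 1))) (Or.inl (by linarith)) using 1
    rw [freeProbLimit, show -((m : ℝ) / ((m : ℝ) - 1)) = -(1 / ((m : ℝ) - 1)) - 1 by
      field_simp; ring]
    field_simp
  rw [intervalIntegral.integral_eq_sub_of_hasDerivAt hderiv
    (intervalIntegrable_freeProbLimit hm ht)]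
  simp

/-- With `y t = 1 - ∫ s in t..1, H s`, the equation `H = y ^ m` reads `y' = y ^ m`, `y 1 = 1`, which
integrates to `y ^ (1 - m) = m - (m - 1) t`. This is the source of the closed form. -/
theorem freeProbLimit_eq_pow (hm : 2 ≤ m) {t : ℝ} (ht : t ≤ 1) :
    freeProbLimit m t = (1 - ∫ s in t..1, freeProbLimit m s) ^ m := by
  have hb := one_le_freeProbLimit_base hm ht
  rw [integral_freeProbLimit hm ht, sub_sub_cancel, ← Real.rpow_natCast, ← Real.rpow_mul
    (by linarith), freeProbLimit]
  congr 1
  ring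

/-- Picard iteration: `x ↦ x ^ m` is `m`-Lipschitz on the unit interval, and integrating the
previous bound from `t` to 1 supplies the factor `(1 - t) / (n + 1)`. -/
theorem abs_freeProb_sub_freeProbLimit_le (hm : 2 ≤ m) (n : ℕ) {t : ℝ}
    (ht : t ∈ Set.Icc (0 : ℝ) 1) :
    |freeProb m n t - freeProbLimit m t| ≤ (m * (1 - t)) ^ n / n.factorial := by
  induction n generalizing t with
  | zero =>
    have := freeProbLimit_mem_Icc hm ht.2
    simp only [freeProb, pow_zero, Nat.factorial_zero, Nat.cast_one, div_one]
    rw [abs_of_nonneg (by linarith [this.2])]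
    linarith [this.1]
  | succ n ih =>
    have hi1 := (continuous_freeProb m n).intervalIntegrable (μ := volume) t 1
    have hi2 := intervalIntegrable_freeProbLimit hm ht.2
    have h1 := intervalIntegral_mem_Icc ht (fun s hs => freeProb_mem_Icc m n hs) hi1
    have h2 := intervalIntegral_mem_Icc ht (fun s hs => freeProbLimit_mem_Icc hm hs.2) hi2
    rw [freeProbLimit_eq_pow hm ht.2, freeProb]
    have hpoly : ∫ s in t..1, (m * (1 - s)) ^ n / n.factorial =
        (m : ℝ) ^ n * (1 - t) ^ (n + 1) / (n + 1).factorial := by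
      simp_rw [mul_pow, mul_div_right_comm]
      rw [intervalIntegral.integral_const_mul,
        intervalIntegral.integral_comp_sub_left (fun s => s ^ n), integral_pow]
      simp only [sub_self, Nat.factorial_succ]
      push_cast
      have : (n.factorial : ℝ) ≠ 0 := by positivity
      field_simp
      ring
    set A := ∫ s in t..1, freeProb m n s
    set B := ∫ s in t..1, freeProbLimit m s
    have hAB : |A - B| ≤ (m : ℝ) ^ n * (1 - t) ^ (n + 1) / (n + 1).factorial := by
      rw [← intervalIntegral.integral_sub hi1 hi2, ← hpoly]
      refine (intervalIntegral.abs_integral_le_integral_abs ht.2).trans ?_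
      refine intervalIntegral.integral_mono_on ht.2 (hi1.sub hi2).abs
        (Continuous.intervalIntegrable (by fun_prop) _ _) fun s hs => ?_
      exact ih ⟨ht.1.trans hs.1, hs.2⟩
    have hpow : |(1 - A) ^ m - (1 - B) ^ m| ≤ |A - B| * m := by
      refine (abs_pow_sub_pow_le _ _ _).trans ?_
      have : (1 - A) - (1 - B) = -(A - B) := by ring
      rw [this, abs_neg, mul_comm (|A - B| * m)]
      refine mul_le_of_le_one_left (by positivity) (pow_le_one₀ (by positivity) (max_le ?_ ?_))
      · rw [abs_of_nonneg (by linarith [h1.2])]; linarith [h1.1]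
      · rw [abs_of_nonneg (by linarith [h2.2])]; linarith [h2.1]
    refine hpow.trans ((mul_le_mul_of_nonneg_right hAB (by positivity)).trans (le_of_eq ?_))
    rw [mul_pow]
    ring

theorem tendsto_freeProb (hm : 2 ≤ m) {t : ℝ} (ht : t ∈ Set.Icc (0 : ℝ) 1) :
    Tendsto (fun n => freeProb m n t) atTop (𝓝 (freeProbLimit m t)) := by
  rw [tendsto_iff_norm_sub_tendsto_zero]
  exact squeeze_zero (fun _ => norm_nonneg _)
    (fun n => abs_freeProb_sub_freeProbLimit_le hm n ht)
    (FloorSemiring.tendsto_pow_div_factorial_atTop _)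

end

end GreedyMatching

/-! ### The distribution function of an atomless law -/

namespace ProbabilityTheory

theorem cdf_mem_Icc (μ : Measure ℝ) (x : ℝ) : cdf μ x ∈ Set.Icc (0 : ℝ) 1 :=
  ⟨cdf_nonneg μ x, cdf_le_one μ x⟩

variable (μ : Measure ℝ) [IsProbabilityMeasure μ] [NullSingletonClass μ]

theorem continuous_cdf_of_noAtoms : Continuous (cdf μ) := by
  refine continuous_iff_continuousAt.2 fun x => ?_
  rw [(monotone_cdf μ).continuousAt_iff_leftLim_eq_rightLim, (cdf μ).rightLim_eq]
  have h := (cdf μ).measure_singleton x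
  rw [measure_cdf, measure_singleton] at h
  have h1 := ENNReal.ofReal_eq_zero.1 h.symm
  exact le_antisymm ((monotone_cdf μ).leftLim_le le_rfl) (by linarith)

theorem exists_cdf_eq {t : ℝ} (ht : t ∈ Set.Ioo (0 : ℝ) 1) : ∃ s, cdf μ s = t := by
  refine mem_range_of_exists_le_of_exists_ge (continuous_cdf_of_noAtoms μ) ?_ ?_
  · obtain ⟨s, hs⟩ := ((tendsto_cdf_atBot μ).eventually_lt_const ht.1).exists
    exact ⟨s, hs.le⟩
  · obtain ⟨s, hs⟩ := ((tendsto_cdf_atTop μ).eventually_const_lt ht.2).exists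
    exact ⟨s, hs.le⟩

/-- The distribution function may be constant on intervals, so the set can reach beyond a point `s`
with `cdf μ s = t`. The upper bound therefore goes through levels `b > t`. -/
theorem measureReal_cdf_le {t : ℝ} (ht : t ∈ Set.Ico (0 : ℝ) 1) :
    μ.real {x | cdf μ x ≤ t} = t := by
  refine le_antisymm (le_of_forall_gt_imp_ge_of_dense fun b hb => ?_) ?_
  · rcases lt_or_ge b 1 with hb1 | hb1
    · obtain ⟨s, hs⟩ := exists_cdf_eq μ ⟨ht.1.trans_lt hb, hb1⟩
      rw [← hs, cdf_eq_real]
      refine measureReal_mono fun x hx => ?_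
      by_contra hxs
      have := monotone_cdf μ (not_le.1 hxs).le
      rw [hs] at this
      exact absurd (this.trans hx) (not_le.2 hb)
    · exact measureReal_le_one.trans hb1
  · rcases ht.1.eq_or_lt with h0 | h0
    · rw [← h0]; exact measureReal_nonneg
    · obtain ⟨s, hs⟩ := exists_cdf_eq μ ⟨h0, ht.2⟩
      calc t = μ.real (Set.Iic s) := by rw [← cdf_eq_real, hs]
        _ ≤ _ := measureReal_mono fun x hx => (monotone_cdf μ hx).trans hs.le

/-- The probability integral transform. -/
theorem map_cdf : μ.map (cdf μ) = volume.restrict (Set.Icc 0 1) := by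
  have hmeas : Measurable (cdf μ) := (monotone_cdf μ).measurable
  have := Measure.isProbabilityMeasure_map hmeas.aemeasurable (μ := μ)
  refine Measure.ext_of_Iic _ _ fun t => ?_
  rw [Measure.map_apply hmeas measurableSet_Iic, Measure.restrict_apply measurableSet_Iic]
  rcases lt_or_ge t 0 with ht0 | ht0
  · have h1 : cdf μ ⁻¹' Set.Iic t = ∅ := by
      ext x; simpa using ht0.trans_le (cdf_nonneg μ x)
    have h2 : Set.Iic t ∩ Set.Icc (0 : ℝ) 1 = ∅ :=
      Set.eq_empty_iff_forall_notMem.2 fun x hx => absurd (hx.2.1.trans hx.1) (not_le.2 ht0)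
    rw [h1, h2, measure_empty, measure_empty]
  rcases lt_or_ge t 1 with ht1 | ht1
  · have h2 : Set.Iic t ∩ Set.Icc (0 : ℝ) 1 = Set.Icc 0 t := by
      ext x; simp only [Set.mem_inter_iff, Set.mem_Iic, Set.mem_Icc]
      exact ⟨fun h => ⟨h.2.1, h.1⟩, fun h => ⟨h.2, h.1, h.2.trans ht1.le⟩⟩
    have h3 := measureReal_cdf_le μ ⟨ht0, ht1⟩
    rw [h2, Real.volume_Icc, sub_zero, ← ofReal_measureReal]
    exact congrArg ENNReal.ofReal h3
  · have h1 : cdf μ ⁻¹' Set.Iic t = Set.univ := by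
      ext x; simpa using (cdf_le_one μ x).trans ht1
    have h2 : Set.Iic t ∩ Set.Icc (0 : ℝ) 1 = Set.Icc 0 1 :=
      Set.inter_eq_right.2 fun x hx => hx.2.trans ht1
    rw [h1, h2, measure_univ, Real.volume_Icc]
    simp

/-- The event that `cdf μ y` exceeds `cdf μ x` is contained in `y > x` and has the same measure, so
the two differ by a null set; on the former the integral can be transported to the unit interval. -/
theorem setIntegral_Ioi_comp_cdf {φ : ℝ → ℝ} (hφ : Continuous φ) (x : ℝ) :
    ∫ y in Set.Ioi x, φ (cdf μ y) ∂μ = ∫ t in cdf μ x..1, φ t := by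
  have hmeas : Measurable (cdf μ) := (monotone_cdf μ).measurable
  have hsub : cdf μ ⁻¹' Set.Ioi (cdf μ x) ⊆ Set.Ioi x := fun y hy => by
    by_contra hyx
    exact absurd (monotone_cdf μ (not_lt.1 hyx)) (not_le.2 hy)
  have hmμ : μ (cdf μ ⁻¹' Set.Ioi (cdf μ x)) = ENNReal.ofReal (1 - cdf μ x) := by
    rw [← Measure.map_apply hmeas measurableSet_Ioi, map_cdf,
      Measure.restrict_apply measurableSet_Ioi]
    have : Set.Ioi (cdf μ x) ∩ Set.Icc (0 : ℝ) 1 = Set.Ioc (cdf μ x) 1 := by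
      ext s; simp only [Set.mem_inter_iff, Set.mem_Ioi, Set.mem_Icc, Set.mem_Ioc]
      exact ⟨fun h => ⟨h.1, h.2.2⟩, fun h => ⟨h.1, ((cdf_nonneg μ x).trans_lt h.1).le, h.2⟩⟩
    rw [this, Real.volume_Ioc]
  have hmx : μ (Set.Ioi x) = ENNReal.ofReal (1 - cdf μ x) := by
    rw [← Set.compl_Iic, prob_compl_eq_one_sub measurableSet_Iic, ← ofReal_cdf,
      ENNReal.ofReal_sub _ (cdf_nonneg μ x), ENNReal.ofReal_one]
  have hae : cdf μ ⁻¹' Set.Ioi (cdf μ x) =ᵐ[μ] Set.Ioi x :=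
    ae_eq_of_subset_of_measure_ge hsub (by rw [hmμ, hmx])
      (hmeas measurableSet_Ioi).nullMeasurableSet (measure_ne_top _ _)
  rw [← setIntegral_congr_set hae, ← setIntegral_map measurableSet_Ioi
    hφ.aestronglyMeasurable hmeas.aemeasurable, map_cdf,
    Measure.restrict_restrict measurableSet_Ioi,
    intervalIntegral.integral_of_le (cdf_le_one μ x)]
  congr 2
  ext s; simp only [Set.mem_inter_iff, Set.mem_Ioi, Set.mem_Icc, Set.mem_Ioc]
  exact ⟨fun h => ⟨h.1, h.2.2⟩, fun h => ⟨h.1, ((cdf_nonneg μ x).trans_lt h.1).le, h.2⟩⟩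

end ProbabilityTheory

/-! ### Independence over disjoint edge sets and the expectation of the truncated recursion -/

open Classical in
/-- Taking the coordinates in `s` from one sample and the others from an independent one preserves
a product measure. -/
theorem MeasureTheory.measurePreserving_piecewise {ι : Type*} [Fintype ι] {α : Type*}
    [MeasurableSpace α] (μ : Measure α) [IsProbabilityMeasure μ] (s : Set ι) :
    MeasurePreserving (fun p : (ι → α) × (ι → α) => s.piecewise p.1 p.2)
      ((Measure.pi fun _ : ι => μ).prod (Measure.pi fun _ : ι => μ))
      (Measure.pi fun _ : ι => μ) := by
  have hmeas : Measurable fun p : (ι → α) × (ι → α) => s.piecewise p.1 p.2 := by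
    refine measurable_pi_iff.2 fun i => ?_
    by_cases hi : i ∈ s <;> simp only [Set.piecewise, hi, if_true, if_false] <;> fun_prop
  refine ⟨hmeas, (Measure.pi_eq fun t ht => ?_).symm⟩
  rw [Measure.map_apply hmeas (MeasurableSet.univ_pi ht)]
  have hpre : (fun p : (ι → α) × (ι → α) => s.piecewise p.1 p.2) ⁻¹' Set.univ.pi t =
      (Set.univ.pi fun i => if i ∈ s then t i else Set.univ) ×ˢ
        (Set.univ.pi fun i => if i ∈ s then Set.univ else t i) := by
    ext p
    simp only [Set.mem_preimage, Set.mem_univ_pi, Set.mem_prod, ← forall_and]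
    refine forall_congr' fun i => ?_
    by_cases hi : i ∈ s <;> simp [hi]
  rw [hpre, Measure.prod_prod, Measure.pi_pi, Measure.pi_pi, ← Finset.prod_mul_distrib]
  refine Finset.prod_congr rfl fun i _ => ?_
  by_cases hi : i ∈ s <;> simp [hi]

namespace GreedyMatching

variable {V : Type} {G : SimpleGraph V}

theorem measurable_extendWeights : Measurable (extendWeights (G := G)) := by
  refine measurable_pi_iff.2 fun e => ?_
  by_cases he : e ∈ G.edgeSet
  · simp only [extendWeights, he, dif_pos]
    fun_prop
  · simp only [extendWeights, he, dif_neg, not_false_iff]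
    fun_prop

variable [Fintype V] (μ : Measure ℝ) [IsProbabilityMeasure μ]

instance : IsProbabilityMeasure (weightLaw G μ) := by
  unfold weightLaw
  infer_instance

theorem measurePreserving_extendWeights_apply {e : Sym2 V} (he : e ∈ G.edgeSet) :
    MeasurePreserving (fun w : G.edgeSet → ℝ => extendWeights w e) (weightLaw G μ) μ := by
  classical
  simp only [extendWeights_of_mem _ he]
  exact measurePreserving_eval (fun _ : G.edgeSet => μ) ⟨e, he⟩

/-- The weights on disjoint sets of edges are independent. -/
theorem integral_weightLaw_eq_integral_prod {S T : Set (Sym2 V)} (hST : Disjoint S T)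
    {f : (Sym2 V → ℝ) × (Sym2 V → ℝ) → ℝ} (hf : Measurable f)
    (hS : ∀ w, DependsOn (fun w' => f (w', w)) S) (hT : ∀ w, DependsOn (fun w' => f (w, w')) T) :
    ∫ w, f (extendWeights w, extendWeights w) ∂(weightLaw G μ) =
      ∫ p, f (extendWeights p.1, extendWeights p.2) ∂((weightLaw G μ).prod (weightLaw G μ)) := by
  classical
  have hmp := measurePreserving_piecewise μ (Subtype.val ⁻¹' S : Set G.edgeSet)
  have hext := measurable_extendWeights (G := G)
  have hmeas : Measurable fun w : G.edgeSet → ℝ => f (extendWeights w, extendWeights w) :=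
    hf.comp (hext.prodMk hext)
  unfold weightLaw
  rw [← hmp.map_eq, integral_map hmp.measurable.aemeasurable hmeas.aestronglyMeasurable, hmp.map_eq]
  refine integral_congr_ae (Eventually.of_forall fun p => ?_)
  -- The spliced sample agrees with `p.1` on `S` and, by disjointness, with `p.2` on `T`; `f` sees
  -- nothing else.
  refine (hS _ (y := extendWeights p.1) fun e he => ?_).trans (hT _ fun e he => ?_)
  · by_cases h : e ∈ G.edgeSet <;> simp [extendWeights, h, Set.piecewise, he]
  · have := Set.disjoint_right.1 hST he
    by_cases h : e ∈ G.edgeSet <;> simp [extendWeights, h, Set.piecewise, this]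

theorem integral_weightLaw_mul {S T : Set (Sym2 V)} (hST : Disjoint S T)
    {f g : (Sym2 V → ℝ) → ℝ} (hf : Measurable f) (hg : Measurable g) (hS : DependsOn f S)
    (hT : DependsOn g T) :
    ∫ w, f (extendWeights w) * g (extendWeights w) ∂(weightLaw G μ) =
      (∫ w, f (extendWeights w) ∂(weightLaw G μ)) *
        ∫ w, g (extendWeights w) ∂(weightLaw G μ) := by
  rw [integral_weightLaw_eq_integral_prod μ hST (f := fun p => f p.1 * g p.2) (by fun_prop)
    (fun w x y hxy => by simp only [hS hxy]) (fun w x y hxy => by simp only [hT hxy])]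
  exact integral_prod_mul (fun w => f (extendWeights w)) fun w => g (extendWeights w)

theorem integral_weightLaw_finset_prod {ι : Type*} (s : Finset ι) {S : ι → Set (Sym2 V)}
    (hS : (s : Set ι).PairwiseDisjoint S) {f : ι → (Sym2 V → ℝ) → ℝ} (hf : ∀ i, Measurable (f i))
    (hd : ∀ i, DependsOn (f i) (S i)) :
    ∫ w, ∏ i ∈ s, f i (extendWeights w) ∂(weightLaw G μ) =
      ∏ i ∈ s, ∫ w, f i (extendWeights w) ∂(weightLaw G μ) := by
  classical
  induction s using Finset.induction_on with
  | empty => simp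
  | insert a s ha ih =>
    simp only [Finset.prod_insert ha]
    rw [integral_weightLaw_mul μ (S := S a) (T := ⋃ i ∈ s, S i) (g := fun w => ∏ i ∈ s, f i w)
      ?_ (hf a) (Finset.measurable_prod _ fun i _ => hf i) (hd a) ?_,
      ih (hS.subset (by simp))]
    · refine Set.disjoint_iUnion₂_right.2 fun i hi => hS (by simp) (by simp [hi]) ?_
      rintro rfl
      exact ha hi
    · intro x y hxy
      exact Finset.prod_congr rfl fun i hi =>
        hd i fun e he => hxy e (Set.mem_iUnion₂.2 ⟨i, hi, he⟩)

/-- Integrating first over the weight of the edge `e`, of which the other weights are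
independent. -/
theorem integral_weightLaw_apply {e : Sym2 V} (he : e ∈ G.edgeSet) {T : Set (Sym2 V)} (heT : e ∉ T)
    {f : ℝ × (Sym2 V → ℝ) → ℝ} (hf : Measurable f) (hT : ∀ y, DependsOn (fun w => f (y, w)) T)
    (hint : Integrable (fun p : ℝ × (G.edgeSet → ℝ) => f (p.1, extendWeights p.2))
      (μ.prod (weightLaw G μ))) :
    ∫ w, f (extendWeights w e, extendWeights w) ∂(weightLaw G μ) =
      ∫ y, ∫ w, f (y, extendWeights w) ∂(weightLaw G μ) ∂μ := by
  have hext := measurable_extendWeights (G := G)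
  rw [integral_weightLaw_eq_integral_prod μ (S := {e}) (T := T) (Set.disjoint_singleton_left.2 heT)
    (f := fun p => f (p.1 e, p.2)) (by fun_prop) (fun w x y hxy => by simp only [hxy e rfl])
    (fun w => hT _), ← integral_prod _ hint]
  have hmp := (measurePreserving_extendWeights_apply μ he).prod
    (MeasurePreserving.id (weightLaw G μ))
  have hm : Measurable fun p : ℝ × (G.edgeSet → ℝ) => f (p.1, extendWeights p.2) :=
    hf.comp (measurable_fst.prodMk (hext.comp measurable_snd))
  conv_rhs => rw [← hmp.map_eq]
  rw [integral_map hmp.measurable.aemeasurable hm.aestronglyMeasurable]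
  rfl

theorem measurable_freeApprox (n : ℕ) (u v : V) :
    Measurable fun p : ℝ × (Sym2 V → ℝ) => freeApprox G p.2 n u v p.1 := by
  classical
  induction n generalizing u v with
  | zero => exact measurable_const
  | succ n ih =>
    refine Finset.measurable_prod _ fun c _ => measurable_const.sub ?_
    have hw : Measurable fun p : ℝ × (Sym2 V → ℝ) => p.2 s(v, c) := by fun_prop
    exact Measurable.ite (measurableSet_lt measurable_fst hw)
      ((ih v c).comp (hw.prodMk measurable_snd)) measurable_const

theorem dependsOn_freeApprox (n : ℕ) (u v : V) (x : ℝ) :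
    DependsOn (fun w => freeApprox G w n u v x)
      (⋃ c ∈ {c | G.Adj v c ∧ c ≠ u}, G.branch n v c) := by
  classical
  induction n generalizing u v x with
  | zero => exact fun _ _ _ => rfl
  | succ n ih =>
    intro w w' h
    refine Finset.prod_congr rfl fun c hc => ?_
    have hc' : c ∈ {c | G.Adj v c ∧ c ≠ u} := by simpa [and_comm] using hc
    have h1 : w s(v, c) = w' s(v, c) :=
      h _ (Set.mem_iUnion₂.2 ⟨c, hc', SimpleGraph.mk_mem_branch _ _ _⟩)
    have h2 : freeApprox G w n v c (w' s(v, c)) = freeApprox G w' n v c (w' s(v, c)) :=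
      ih v c _ fun e he => h _ (Set.mem_iUnion₂.2 ⟨c, hc', Or.inr he⟩)
    rw [h1, h2]

section

variable [NullSingletonClass μ] {m : ℕ}

theorem integrable_of_mem_Icc {α : Type*} [MeasurableSpace α] {ν : Measure α} [IsFiniteMeasure ν]
    {f : α → ℝ} (hf : Measurable f) (h : ∀ x, f x ∈ Set.Icc (0 : ℝ) 1) : Integrable f ν :=
  Integrable.of_bound hf.aestronglyMeasurable 1 (Eventually.of_forall fun x => by
    rw [Real.norm_eq_abs, abs_of_nonneg (h x).1]
    exact (h x).2)

/-- The factors for different neighbours of `v` use disjoint branches, so the expectation of the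
product factorizes. In each factor the weight of `s(v, c)` is independent of the branches beyond
`c`, and integrating over it turns `y > x` into quantiles above `cdf μ x`. -/
theorem integral_freeApprox (hdeg : ∀ v, (G.neighborSet v).ncard = m + 1) (n : ℕ)
    (hg : ((2 * n + 2 : ℕ) : ℕ∞) < G.egirth) {u v : V} (huv : G.Adj u v) (x : ℝ) :
    ∫ w, freeApprox G (extendWeights w) n u v x ∂(weightLaw G μ) =
      freeProb m n (ProbabilityTheory.cdf μ x) := by
  classical
  induction n generalizing u v x with
  | zero => simp [freeApprox, freeProb]
  | succ n ih =>
    have hg' : ((2 * n + 2 : ℕ) : ℕ∞) < G.egirth :=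
      lt_of_le_of_lt (by exact_mod_cast (by omega)) hg
    have hadj : ∀ c ∈ (G.neighborFinset v).erase u, G.Adj v c ∧ c ≠ u := fun c hc => by
      simpa [and_comm] using hc
    have hmeas : ∀ c, Measurable fun p : ℝ × (Sym2 V → ℝ) =>
        if x < p.1 then freeApprox G p.2 n v c p.1 else 0 := fun c =>
      Measurable.ite (measurableSet_lt measurable_const measurable_fst)
        (measurable_freeApprox n v c) measurable_const
    have hIcc : ∀ c (p : ℝ × (Sym2 V → ℝ)),
        (if x < p.1 then freeApprox G p.2 n v c p.1 else 0) ∈ Set.Icc (0 : ℝ) 1 := by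
      intro c p
      split_ifs
      · exact freeApprox_mem_Icc _ _ _ _
      · simp
    have hmeas' : ∀ c, Measurable fun w : Sym2 V → ℝ =>
        if x < w s(v, c) then freeApprox G w n v c (w s(v, c)) else 0 := by
      intro c
      have hw : Measurable fun w : Sym2 V → ℝ => (w s(v, c), w) := by fun_prop
      exact (hmeas c).comp hw
    have hext := measurable_extendWeights (G := G)
    have hfactor : ∀ c ∈ (G.neighborFinset v).erase u,
        ∫ w, (1 - if x < extendWeights w s(v, c) then
          freeApprox G (extendWeights w) n v c (extendWeights w s(v, c)) else 0)
          ∂(weightLaw G μ) =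
        1 - ∫ t in ProbabilityTheory.cdf μ x..1, freeProb m n t := by
      intro c hc
      have hvc := hadj c hc
      have hint : Integrable (fun w : G.edgeSet → ℝ => if x < extendWeights w s(v, c) then
          freeApprox G (extendWeights w) n v c (extendWeights w s(v, c)) else 0)
          (weightLaw G μ) :=
        integrable_of_mem_Icc ((hmeas' c).comp hext) fun w => hIcc c (_, _)
      rw [integral_sub (integrable_const _) hint, integral_weightLaw_apply μ (G.mem_edgeSet.2 hvc.1)
        (T := ⋃ d ∈ {d | G.Adj c d ∧ d ≠ v}, G.branch n c d) ?_
        (f := fun p => if x < p.1 then freeApprox G p.2 n v c p.1 else 0) (hmeas c) ?_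
        (integrable_of_mem_Icc ((hmeas c).comp (measurable_fst.prodMk (hext.comp measurable_snd)))
          fun p => hIcc c (_, _))]
      · rw [← ProbabilityTheory.setIntegral_Ioi_comp_cdf μ (continuous_freeProb m n) x,
          ← integral_indicator measurableSet_Ioi]
        simp only [integral_const, probReal_univ, one_smul, sub_right_inj]
        refine integral_congr_ae (Eventually.of_forall fun y => ?_)
        by_cases hy : x < y
        · simpa [hy] using ih hg' hvc.1 y
        · simp [hy]
      · simp only [Set.mem_iUnion, not_exists]
        exact fun d hd => SimpleGraph.notMem_branch hg' hvc.1 hd.1 hd.2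
      · intro y w w' h
        have := dependsOn_freeApprox n v c y h
        dsimp only at this ⊢
        rw [this]
    have hcard : ((G.neighborFinset v).erase u).card = m := by
      rw [Finset.card_erase_of_mem (by simpa using huv.symm), SimpleGraph.neighborFinset,
        ← Set.ncard_eq_toFinset_card', hdeg]
      rfl
    simp only [freeApprox]
    rw [integral_weightLaw_finset_prod μ ((G.neighborFinset v).erase u)
      (S := fun c => G.branch (n + 1) v c) ?_ (f := fun c w => 1 - if x < w s(v, c) then
          freeApprox G w n v c (w s(v, c)) else 0) (fun c => measurable_const.sub (hmeas' c)) ?_,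
      Finset.prod_congr rfl hfactor, Finset.prod_const, hcard, freeProb]
    · intro c hc c' hc' hcc
      exact SimpleGraph.disjoint_branch hg (hadj c hc).1 (hadj c' hc').1 hcc
    · intro c w w' h
      have h1 : w s(v, c) = w' s(v, c) := h _ (SimpleGraph.mk_mem_branch _ _ _)
      have h2 : freeApprox G w n v c (w' s(v, c)) = freeApprox G w' n v c (w' s(v, c)) :=
        dependsOn_freeApprox n v c _ fun e he => h _ (Or.inr he)
      dsimp only
      rw [h1, h2]

/-- The expected weight that an edge contributes to the depth-`n` approximation of GREEDY. -/
theorem integral_mul_freeApprox_mul_freeApprox (hμ : Integrable (fun x => x) μ)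
    (hdeg : ∀ v, (G.neighborSet v).ncard = m + 1) (n : ℕ)
    (hg : ((2 * (n + 1) + 2 : ℕ) : ℕ∞) < G.egirth) {u v : V} (huv : G.Adj u v) :
    ∫ w, extendWeights w s(u, v) *
      (freeApprox G (extendWeights w) n u v (extendWeights w s(u, v)) *
        freeApprox G (extendWeights w) n v u (extendWeights w s(u, v))) ∂(weightLaw G μ) =
      ∫ y, y * freeProb m n (ProbabilityTheory.cdf μ y) ^ 2 ∂μ := by
  have hg' : ((2 * n + 2 : ℕ) : ℕ∞) < G.egirth :=
    lt_of_le_of_lt (by exact_mod_cast (by omega)) hg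
  have hmeas : Measurable fun p : ℝ × (Sym2 V → ℝ) =>
      p.1 * (freeApprox G p.2 n u v p.1 * freeApprox G p.2 n v u p.1) :=
    measurable_fst.mul ((measurable_freeApprox n u v).mul (measurable_freeApprox n v u))
  rw [integral_weightLaw_apply μ (G.mem_edgeSet.2 huv)
    (T := (⋃ c ∈ {c | G.Adj v c ∧ c ≠ u}, G.branch n v c) ∪
      ⋃ d ∈ {d | G.Adj u d ∧ d ≠ v}, G.branch n u d) ?_
    (f := fun p => p.1 * (freeApprox G p.2 n u v p.1 * freeApprox G p.2 n v u p.1)) hmeas ?_ ?_]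
  · refine integral_congr_ae (Eventually.of_forall fun y => ?_)
    dsimp only
    rw [integral_const_mul, integral_weightLaw_mul μ
      (f := fun w => freeApprox G w n u v y) (g := fun w => freeApprox G w n v u y) ?_
      ((measurable_freeApprox n u v).comp (measurable_const.prodMk measurable_id))
      ((measurable_freeApprox n v u).comp (measurable_const.prodMk measurable_id))
      (dependsOn_freeApprox n u v y) (dependsOn_freeApprox n v u y),
      integral_freeApprox μ hdeg n hg' huv, integral_freeApprox μ hdeg n hg' huv.symm, sq]
    -- Everything is viewed from `v`: the branches beyond `u` sit inside the branch of depth `n + 1`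
    -- towards `u`. This is why the girth hypothesis has `n + 1`.
    refine Set.disjoint_iUnion₂_left.2 fun c hc => Set.disjoint_iUnion₂_right.2 fun d hd => ?_
    exact (SimpleGraph.disjoint_branch hg hc.1 huv.symm hc.2).mono
      (SimpleGraph.branch_subset_succ n v c) (Set.subset_union_of_subset_right
        (Set.subset_biUnion_of_mem (u := fun d => G.branch n u d) hd) _)
  · simp only [Set.mem_union, Set.mem_iUnion, not_or, not_exists]
    refine ⟨fun c hc => SimpleGraph.notMem_branch hg' huv hc.1 hc.2, fun d hd => ?_⟩
    rw [Sym2.eq_swap]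
    exact SimpleGraph.notMem_branch hg' huv.symm hd.1 hd.2
  · intro y w w' h
    have h1 : freeApprox G w n u v y = freeApprox G w' n u v y :=
      dependsOn_freeApprox n u v y fun e he => h e (Or.inl he)
    have h2 : freeApprox G w n v u y = freeApprox G w' n v u y :=
      dependsOn_freeApprox n v u y fun e he => h e (Or.inr he)
    dsimp only
    rw [h1, h2]
  · refine (hμ.comp_fst (weightLaw G μ)).mono (hmeas.comp (measurable_fst.prodMk
      (measurable_extendWeights.comp measurable_snd))).aestronglyMeasurable
      (Eventually.of_forall fun p => ?_)
    have h1 := freeApprox_mem_Icc (G := G) (w := extendWeights p.2) n u v p.1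
    have h2 := freeApprox_mem_Icc (G := G) (w := extendWeights p.2) n v u p.1
    simp only [norm_mul, Real.norm_eq_abs, abs_of_nonneg h1.1, abs_of_nonneg h2.1]
    exact mul_le_of_le_one_right (abs_nonneg _) (mul_le_one₀ h1.2 h2.1 h2.2)

end

end GreedyMatching

/-! ### Bounds for the contribution of one edge and for the ratio -/

namespace GreedyMatching

variable {V : Type} {G : SimpleGraph V} [Fintype V]

open Classical in
/-- The indicator of the event that GREEDY selects the edge `e`. -/
noncomputable def selected (w : G.edgeSet → ℝ) (e : G.edgeSet) : ℝ :=
  if e ∈ run w (Finset.univ : Finset G.edgeSet) then 1 else 0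

theorem selected_mem_Icc (w : G.edgeSet → ℝ) (e : G.edgeSet) :
    selected w e ∈ Set.Icc (0 : ℝ) 1 := by
  unfold selected
  split_ifs <;> simp

open Classical in
theorem weight_eq_sum_selected (w : G.edgeSet → ℝ) :
    weight G w = ∑ e : G.edgeSet, w e * selected w e := by
  simp [weight, selected, Finset.sum_ite_mem]

open Classical in
theorem exists_selected_eq {w : G.edgeSet → ℝ} (hw : Function.Injective w) :
    ∃ M, IsGreedy G M (extendWeights w) ∧ ∀ u v (h : G.Adj u v),
      selected w ⟨s(u, v), h⟩ = (if IsFree G M (extendWeights w) u v then 1 else 0) *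
        if IsFree G M (extendWeights w) v u then 1 else 0 := by
  have hM := isGreedy_run hw
  refine ⟨_, hM, fun u v h => ?_⟩
  have h1 := hM h
  have h2 : s(u, v) ∈ Subtype.val '' (run w Finset.univ : Set G.edgeSet) ↔
      (⟨s(u, v), h⟩ : G.edgeSet) ∈ run w Finset.univ := by
    have : s(u, v) ∈ G.edgeSet := h
    simp [h]
  rw [h2] at h1
  unfold selected
  by_cases hs : (⟨s(u, v), h⟩ : G.edgeSet) ∈ run w Finset.univ
  · rw [if_pos hs, if_pos (h1.1 hs).1, if_pos (h1.1 hs).2, one_mul]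
  · rw [if_neg hs]
    by_cases h3 : IsFree G (Subtype.val '' (run w Finset.univ : Set G.edgeSet))
      (extendWeights w) u v
    · rw [if_neg fun h4 => hs (h1.2 ⟨h3, h4⟩), mul_zero]
    · rw [if_neg h3, zero_mul]

/-- The product of the depth-`n` approximations at the two endpoints of the edge `s(u, v)`. -/
noncomputable def selectedApprox (G : SimpleGraph V) (n : ℕ) (u v : V) (w : Sym2 V → ℝ) : ℝ :=
  freeApprox G w n u v (w s(u, v)) * freeApprox G w n v u (w s(u, v))

theorem selectedApprox_mem_Icc (n : ℕ) (u v : V) (w : Sym2 V → ℝ) :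
    selectedApprox G n u v w ∈ Set.Icc (0 : ℝ) 1 :=
  have h1 := freeApprox_mem_Icc (G := G) (w := w) n u v (w s(u, v))
  have h2 := freeApprox_mem_Icc (G := G) (w := w) n v u (w s(u, v))
  ⟨mul_nonneg h1.1 h2.1, mul_le_one₀ h1.2 h2.1 h2.2⟩

theorem measurable_selectedApprox (n : ℕ) (u v : V) :
    Measurable (selectedApprox G n u v) := by
  have hw : Measurable fun w : Sym2 V → ℝ => (w s(u, v), w) := by fun_prop
  exact ((measurable_freeApprox n u v).comp hw).mul ((measurable_freeApprox n v u).comp hw)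

theorem selected_mem_Icc_selectedApprox {w : G.edgeSet → ℝ} (hw : Function.Injective w) (k : ℕ)
    {u v : V} (h : G.Adj u v) :
    selected w ⟨s(u, v), h⟩ ∈ Set.Icc (selectedApprox G (2 * k + 1) u v (extendWeights w))
      (selectedApprox G (2 * k) u v (extendWeights w)) := by
  obtain ⟨M, hM, hsel⟩ := exists_selected_eq hw
  have h1 := hM.isFree_le_freeApprox k u v
  have h2 := hM.isFree_le_freeApprox k v u
  rw [Sym2.eq_swap (a := v)] at h2
  rw [hsel u v h]
  have h3 := freeApprox_mem_Icc (G := G) (w := extendWeights w) (2 * k + 1) v u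
    (extendWeights w s(u, v))
  refine ⟨mul_le_mul h1.2 h2.2 h3.1 ?_, mul_le_mul h1.1 h2.1 ?_ (freeApprox_mem_Icc _ _ _ _).1⟩ <;>
  split_ifs <;> simp

/-- Serves measurability: `heaviest` is a mere choice, but for distinct weights `selected` agrees
with a measurable function of one fixed depth. -/
theorem exists_selected_eq_selectedApprox (G : SimpleGraph V) :
    ∃ n, ∀ w : G.edgeSet → ℝ, Function.Injective w → ∀ u v (h : G.Adj u v),
      selected w ⟨s(u, v), h⟩ = selectedApprox G n u v (extendWeights w) := by
  classical
  refine ⟨G.edgeFinset.card + 1, fun w hw u v h => ?_⟩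
  obtain ⟨M, hM, hsel⟩ := exists_selected_eq hw
  have hcard : ∀ u v, (G.edgeFinset.filter fun e =>
      extendWeights w s(u, v) < extendWeights w e).card < G.edgeFinset.card + 1 := fun u v =>
    Nat.lt_succ_of_le (Finset.card_filter_le _ _)
  have h1 := hM.freeApprox_eq _ (hcard u v)
  have h2 := hM.freeApprox_eq _ (hcard v u)
  rw [Sym2.eq_swap (a := v)] at h2
  rw [hsel u v h, selectedApprox, h1, h2]

section

variable (μ : Measure ℝ) [IsProbabilityMeasure μ] [NullSingletonClass μ]

theorem ae_injective_weightLaw : ∀ᵐ w ∂(weightLaw G μ), Function.Injective w := by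
  have hne : ∀ e e' : G.edgeSet, e ≠ e' → ∀ᵐ w ∂(weightLaw G μ), w e ≠ w e' := by
    intro e e' hee
    let f : ℝ × (Sym2 V → ℝ) → ℝ := Set.indicator {p | p.1 = p.2 e'} fun _ => 1
    have hset : MeasurableSet {p : ℝ × (Sym2 V → ℝ) | p.1 = p.2 e'} :=
      measurableSet_eq_fun measurable_fst (by fun_prop)
    have hf : Measurable f := measurable_const.indicator hset
    have hfI : ∀ p, f p ∈ Set.Icc (0 : ℝ) 1 := fun p => by
      by_cases hp : p ∈ {p : ℝ × (Sym2 V → ℝ) | p.1 = p.2 e'} <;> simp [f, hp]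
    have hext := measurable_extendWeights (G := G)
    have h := integral_weightLaw_apply μ e.2 (T := {(e' : Sym2 V)})
      (fun h => hee (Subtype.ext h)) hf (fun y x x' hx => by
        simp only [f, Set.indicator, Set.mem_ofPred_eq, hx _ rfl])
      (integrable_of_mem_Icc (hf.comp (measurable_fst.prodMk (hext.comp measurable_snd)))
        fun p => hfI (_, _))
    have hinner : ∀ y, ∫ w, f (y, extendWeights w) ∂(weightLaw G μ) = 0 := by
      intro y
      refine integral_eq_zero_of_ae ?_
      have hy : ∀ᵐ x ∂μ, x ≠ y := by simp [ae_iff]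
      filter_upwards [(measurePreserving_extendWeights_apply μ e'.2).quasiMeasurePreserving.ae hy]
        with w hw
      simp [f, hw.symm]
    simp only [hinner, integral_zero] at h
    have hint : Integrable (fun w : G.edgeSet → ℝ => f (extendWeights w e, extendWeights w))
        (weightLaw G μ) :=
      integrable_of_mem_Icc (hf.comp (((measurable_pi_apply (e : Sym2 V)).comp hext).prodMk hext))
        fun w => hfI (_, _)
    rw [integral_eq_zero_iff_of_nonneg (fun w => (hfI _).1) hint] at h
    filter_upwards [h] with w hw heq
    simp [f, extendWeights_coe, heq] at hw
  have hall : ∀ᵐ w ∂(weightLaw G μ), ∀ e e' : G.edgeSet, e ≠ e' → w e ≠ w e' := by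
    simp only [ae_all_iff]
    exact hne
  filter_upwards [hall] with w hw e e' h
  by_contra hne'
  exact hw e e' hne' h

end

theorem measurePreserving_weightLaw_eval (μ : Measure ℝ) [IsProbabilityMeasure μ] (e : G.edgeSet) :
    MeasurePreserving (fun w : G.edgeSet → ℝ => w e) (weightLaw G μ) μ := by
  classical
  exact measurePreserving_eval (fun _ : G.edgeSet => μ) e

section

variable {μ : Measure ℝ} [IsProbabilityMeasure μ]

theorem integrable_weightLaw_eval (hμ : Integrable (fun x => x) μ) (e : G.edgeSet) :
    Integrable (fun w : G.edgeSet → ℝ => w e) (weightLaw G μ) :=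
  (measurePreserving_weightLaw_eval μ e).integrable_comp_of_integrable hμ

theorem integrable_eval_mul (hμ : Integrable (fun x => x) μ) (e : G.edgeSet)
    {f : (G.edgeSet → ℝ) → ℝ} (hf : AEStronglyMeasurable f (weightLaw G μ))
    (hfI : ∀ w, f w ∈ Set.Icc (0 : ℝ) 1) : Integrable (fun w => w e * f w) (weightLaw G μ) := by
  have h := integrable_weightLaw_eval (G := G) hμ e
  refine h.mono (h.aestronglyMeasurable.mul hf) (Eventually.of_forall fun w => ?_)
  rw [norm_mul, Real.norm_eq_abs (f w), abs_of_nonneg (hfI w).1]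
  exact mul_le_of_le_one_right (norm_nonneg _) (hfI w).2

theorem ae_nonneg_weightLaw (hnonneg : ∀ᵐ x ∂μ, 0 ≤ x) (e : G.edgeSet) :
    ∀ᵐ w ∂(weightLaw G μ), 0 ≤ w e :=
  (measurePreserving_weightLaw_eval μ e).quasiMeasurePreserving.ae hnonneg

variable [NullSingletonClass μ]

theorem integrable_mul_selected (hμ : Integrable (fun x => x) μ) (e : G.edgeSet) :
    Integrable (fun w => w e * selected w e) (weightLaw G μ) := by
  refine integrable_eval_mul hμ e ?_ fun w => selected_mem_Icc w e
  obtain ⟨n, hn⟩ := exists_selected_eq_selectedApprox G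
  obtain ⟨e, he⟩ := e
  induction e using Sym2.ind with
  | _ u v =>
    have hmeas : Measurable fun w : G.edgeSet → ℝ => selectedApprox G n u v (extendWeights w) :=
      (measurable_selectedApprox n u v).comp measurable_extendWeights
    refine hmeas.aestronglyMeasurable.congr ?_
    filter_upwards [ae_injective_weightLaw μ] with w hw
    exact (hn w hw u v he).symm

theorem integrable_weight (hμ : Integrable (fun x => x) μ) :
    Integrable (fun w => weight G w / (Fintype.card V : ℝ)) (weightLaw G μ) := by
  simp only [weight_eq_sum_selected]
  exact (integrable_finsetSum _ fun e _ => integrable_mul_selected hμ e).div_const _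

theorem integral_mul_selected_mem_Icc_zero (hμ : Integrable (fun x => x) μ)
    (hnonneg : ∀ᵐ x ∂μ, 0 ≤ x) (e : G.edgeSet) :
    ∫ w, w e * selected w e ∂(weightLaw G μ) ∈ Set.Icc 0 (∫ x, x ∂μ) := by
  have hw := ae_nonneg_weightLaw (G := G) hnonneg e
  constructor
  · refine integral_nonneg_of_ae ?_
    filter_upwards [hw] with w hw
    exact mul_nonneg hw (selected_mem_Icc w e).1
  · have hmp := measurePreserving_weightLaw_eval (G := G) μ e
    conv_rhs => rw [← hmp.map_eq]
    rw [integral_map hmp.measurable.aemeasurable (by fun_prop)]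
    refine integral_mono_ae (integrable_mul_selected hμ e) (integrable_weightLaw_eval hμ e) ?_
    filter_upwards [hw] with w hw
    exact mul_le_of_le_one_right hw (selected_mem_Icc w e).2

/-- The endpoints depend on `m`, `k` and `μ` but on neither the graph nor the edge; this uniformity
lets infimum and supremum be treated alike. -/
theorem integral_mul_selected_mem_Icc {m : ℕ} (hμ : Integrable (fun x => x) μ)
    (hnonneg : ∀ᵐ x ∂μ, 0 ≤ x) (hdeg : ∀ v, (G.neighborSet v).ncard = m + 1) (k : ℕ)
    (hg : ((4 * k + 6 : ℕ) : ℕ∞) < G.egirth) (e : G.edgeSet) :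
    ∫ w, w e * selected w e ∂(weightLaw G μ) ∈ Set.Icc
      (∫ y, y * freeProb m (2 * k + 1) (ProbabilityTheory.cdf μ y) ^ 2 ∂μ)
      (∫ y, y * freeProb m (2 * k) (ProbabilityTheory.cdf μ y) ^ 2 ∂μ) := by
  obtain ⟨e, he⟩ := e
  induction e using Sym2.ind with
  | _ u v =>
    have hw := ae_nonneg_weightLaw (G := G) hnonneg ⟨s(u, v), he⟩
    have hinj := ae_injective_weightLaw (G := G) μ
    have hint (n : ℕ) : Integrable (fun w : G.edgeSet → ℝ => w ⟨s(u, v), he⟩ *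
        selectedApprox G n u v (extendWeights w)) (weightLaw G μ) :=
      integrable_eval_mul hμ _ ((measurable_selectedApprox n u v).comp
        measurable_extendWeights).aestronglyMeasurable fun w => selectedApprox_mem_Icc _ _ _ _
    have hval (n : ℕ) (hn : n ≤ 2 * k + 1) :
        ∫ y, y * freeProb m n (ProbabilityTheory.cdf μ y) ^ 2 ∂μ =
        ∫ w : G.edgeSet → ℝ, w ⟨s(u, v), he⟩ * selectedApprox G n u v (extendWeights w)
          ∂(weightLaw G μ) := by
      rw [← integral_mul_freeApprox_mul_freeApprox (G := G) μ hμ hdeg n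
        -- The larger depth `2 * k + 1` needs girth above `2 * ((2 * k + 1) + 1) + 2 = 4 * k + 6`.
        (lt_of_le_of_lt (by exact_mod_cast (by omega)) hg) he]
      simp only [selectedApprox, extendWeights_of_mem _ he]
    rw [hval _ le_rfl, hval _ (Nat.le_succ _)]
    constructor
    · refine integral_mono_ae (hint _) (integrable_mul_selected hμ _) ?_
      filter_upwards [hw, hinj] with w hw hinj
      exact mul_le_mul_of_nonneg_left (selected_mem_Icc_selectedApprox hinj k he).1 hw
    · refine integral_mono_ae (integrable_mul_selected hμ _) (hint _) ?_
      filter_upwards [hw, hinj] with w hw hinj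
      exact mul_le_mul_of_nonneg_left (selected_mem_Icc_selectedApprox hinj k he).2 hw

open Classical in
theorem expectedRatio_mem_Icc [Nonempty V] {r : ℕ} (hμ : Integrable (fun x => x) μ)
    (hdeg : ∀ v, (G.neighborSet v).ncard = r) {a b : ℝ}
    (h : ∀ e : G.edgeSet, ∫ w, w e * selected w e ∂(weightLaw G μ) ∈ Set.Icc a b) :
    expectedRatio G μ ∈ Set.Icc ((r : ℝ) / 2 * a) ((r : ℝ) / 2 * b) := by
  -- The handshake identity is the origin of the factor `r / 2`, the number of edges per vertex.
  have hcard : (r : ℝ) * Fintype.card V = 2 * Fintype.card G.edgeSet := by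
    have h1 := G.sum_degrees_eq_twice_card_edges
    have h2 : ∀ v, G.degree v = r := fun v => by
      rw [← hdeg v, SimpleGraph.degree, SimpleGraph.neighborFinset, Set.ncard_eq_toFinset_card']
    simp only [h2, Finset.sum_const, Finset.card_univ, smul_eq_mul] at h1
    rw [SimpleGraph.edgeFinset_card] at h1
    rw [mul_comm]
    exact_mod_cast h1
  have hV : (0 : ℝ) < Fintype.card V := by exact_mod_cast Fintype.card_pos
  have hE : expectedRatio G μ = (∑ e : G.edgeSet, ∫ w, w e * selected w e ∂(weightLaw G μ)) /
      Fintype.card V := by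
    simp only [expectedRatio, weight_eq_sum_selected]
    rw [integral_div, integral_finsetSum _ fun e _ => integrable_mul_selected hμ e]
  have hlo := Finset.card_nsmul_le_sum Finset.univ _ a fun (e : G.edgeSet) _ => (h e).1
  have hhi := Finset.sum_le_card_nsmul Finset.univ _ b fun (e : G.edgeSet) _ => (h e).2
  rw [nsmul_eq_mul, Finset.card_univ] at hlo hhi
  have hr : (r : ℝ) = 2 * Fintype.card G.edgeSet / Fintype.card V := by
    field_simp
    exact hcard
  rw [hE, hr]
  constructor
  · rw [le_div_iff₀ hV]
    field_simp
    exact hlo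
  · rw [div_le_iff₀ hV]
    field_simp
    exact hhi

end

end GreedyMatching

/-! ### Letting the depth tend to infinity, and the theorem -/

namespace GreedyMatching

section

variable {μ : Measure ℝ}

theorem measurable_freeProbLimit (m : ℕ) : Measurable (freeProbLimit m) := by
  unfold freeProbLimit
  fun_prop

theorem integrable_mul_freeProbLimit {m : ℕ} (hm : 2 ≤ m) (hμ : Integrable (fun x => x) μ) :
    Integrable (fun y => y * freeProbLimit m (ProbabilityTheory.cdf μ y) ^ 2) μ := by
  have hmeas : Measurable fun y => y * freeProbLimit m (ProbabilityTheory.cdf μ y) ^ 2 :=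
    measurable_id.mul (((measurable_freeProbLimit m).comp
      (ProbabilityTheory.monotone_cdf μ).measurable).pow_const 2)
  refine hμ.mono hmeas.aestronglyMeasurable (Eventually.of_forall fun y => ?_)
  have h := freeProbLimit_mem_Icc hm (ProbabilityTheory.cdf_le_one μ y)
  rw [norm_mul, Real.norm_eq_abs (_ ^ 2), abs_of_nonneg (sq_nonneg _)]
  exact mul_le_of_le_one_right (norm_nonneg _) (pow_le_one₀ h.1 h.2)

theorem tendsto_integral_mul_freeProb {m : ℕ} (hm : 2 ≤ m) (hμ : Integrable (fun x => x) μ) :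
    Tendsto (fun n => ∫ y, y * freeProb m n (ProbabilityTheory.cdf μ y) ^ 2 ∂μ) atTop
      (𝓝 (∫ y, y * freeProbLimit m (ProbabilityTheory.cdf μ y) ^ 2 ∂μ)) := by
  refine tendsto_integral_of_dominated_convergence (fun y => ‖y‖) (fun n => ?_) hμ.norm
    (fun n => Eventually.of_forall fun y => ?_) (Eventually.of_forall fun y => ?_)
  · exact (measurable_id.mul (((continuous_freeProb m n).measurable.comp
      (ProbabilityTheory.monotone_cdf μ).measurable).pow_const 2)).aestronglyMeasurable
  · have h := freeProb_mem_Icc m n (ProbabilityTheory.cdf_mem_Icc μ y)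
    rw [norm_mul, Real.norm_eq_abs (_ ^ 2), abs_of_nonneg (sq_nonneg _)]
    exact mul_le_of_le_one_right (norm_nonneg _) (pow_le_one₀ h.1 h.2)
  · exact ((tendsto_freeProb hm (ProbabilityTheory.cdf_mem_Icc μ y)).pow 2).const_mul y

theorem freeProbLimit_sq {m : ℕ} (hm : 2 ≤ m) {t : ℝ} (ht : t ≤ 1) :
    freeProbLimit m t ^ 2 =
      ((m : ℝ) - ((m : ℝ) - 1) * t) ^ (-(2 * (m : ℝ) / ((m : ℝ) - 1))) := by
  have hb := one_le_freeProbLimit_base hm ht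
  rw [freeProbLimit, ← Real.rpow_natCast, ← Real.rpow_mul (by linarith)]
  congr 1
  push_cast
  ring

theorem ratios_nonempty (g r : ℕ) (μ : Measure ℝ) : (ratios g r μ).Nonempty := by
  obtain ⟨V, hV, hne, G, hG⟩ := exists_mem_regularGirthFamily g r
  exact ⟨_, V, hV, hne, G, hG, rfl⟩

variable [IsProbabilityMeasure μ] [NullSingletonClass μ]

/-- A crude bound valid for every `g`, including girths too small for the truncation argument. -/
theorem ratios_subset_Icc_zero (g r : ℕ) (hμ : Integrable (fun x => x) μ)
    (hnonneg : ∀ᵐ x ∂μ, 0 ≤ x) :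
    ratios g r μ ⊆ Set.Icc ((r : ℝ) / 2 * 0) ((r : ℝ) / 2 * ∫ x, x ∂μ) := by
  rintro x ⟨V, hV, hne, G, hG, rfl⟩
  exact expectedRatio_mem_Icc hμ hG.1 (integral_mul_selected_mem_Icc_zero hμ hnonneg)

theorem ratios_subset_Icc {m : ℕ} (g k : ℕ) (hgk : 4 * k + 6 < g) (hμ : Integrable (fun x => x) μ)
    (hnonneg : ∀ᵐ x ∂μ, 0 ≤ x) :
    ratios g (m + 1) μ ⊆ Set.Icc
      (((m + 1 : ℕ) : ℝ) / 2 *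
        ∫ y, y * freeProb m (2 * k + 1) (ProbabilityTheory.cdf μ y) ^ 2 ∂μ)
      (((m + 1 : ℕ) : ℝ) / 2 *
        ∫ y, y * freeProb m (2 * k) (ProbabilityTheory.cdf μ y) ^ 2 ∂μ) := by
  rintro x ⟨V, hV, hne, G, hG, rfl⟩
  exact expectedRatio_mem_Icc hμ hG.1 (integral_mul_selected_mem_Icc hμ hnonneg hG.1 k
    (lt_of_lt_of_le (by exact_mod_cast hgk) hG.2))

/-- If the sets `s g` eventually lie in intervals that shrink to `a`, then their infima and suprema
tend to `a`. -/
theorem tendsto_sInf_sSup {s : ℕ → Set ℝ} (hs : ∀ g, (s g).Nonempty) {l u : ℕ → ℝ} {a : ℝ}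
    (hl : Tendsto l atTop (𝓝 a)) (hu : Tendsto u atTop (𝓝 a)) {N : ℕ → ℕ}
    (h : ∀ k g, N k < g → s g ⊆ Set.Icc (l k) (u k)) :
    Tendsto (fun g => sInf (s g)) atTop (𝓝 a) ∧ Tendsto (fun g => sSup (s g)) atTop (𝓝 a) := by
  have hmem : ∀ k g, N k < g → sInf (s g) ∈ Set.Icc (l k) (u k) ∧
      sSup (s g) ∈ Set.Icc (l k) (u k) := by
    intro k g hg
    obtain ⟨x, hx⟩ := hs g
    have hsub := h k g hg
    have hb : BddBelow (s g) := ⟨l k, fun y hy => (hsub hy).1⟩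
    have ha : BddAbove (s g) := ⟨u k, fun y hy => (hsub hy).2⟩
    exact ⟨⟨le_csInf ⟨x, hx⟩ fun y hy => (hsub hy).1, (csInf_le hb hx).trans (hsub hx).2⟩,
      ⟨(hsub hx).1.trans (le_csSup ha hx), csSup_le ⟨x, hx⟩ fun y hy => (hsub hy).2⟩⟩
  constructor <;>
  · refine tendsto_order.2 ⟨fun b hb => ?_, fun b hb => ?_⟩
    · obtain ⟨k, hk⟩ := (hl.eventually_const_lt hb).exists
      filter_upwards [eventually_gt_atTop (N k)] with g hg
      have := hmem k g hg
      first
        | exact hk.trans_le this.1.1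
        | exact hk.trans_le this.2.1
    · obtain ⟨k, hk⟩ := (hu.eventually_lt_const hb).exists
      filter_upwards [eventually_gt_atTop (N k)] with g hg
      have := hmem k g hg
      first
        | exact this.1.2.trans_lt hk
        | exact this.2.2.trans_lt hk

end

end GreedyMatching

theorem mainTheorem11 (r : ℕ) (hr : 3 ≤ r)
    {Ω : Type*} [MeasurableSpace Ω] (P : Measure Ω) [IsProbabilityMeasure P]
    (W : Ω → ℝ) (hWnonneg : ∀ᵐ ω ∂P, 0 ≤ W ω) (hWint : Integrable W P)
    (F : ℝ → ℝ) (hF : ∀ x, F x = P.real {ω | W ω ≤ x})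
    (f : ℝ → ℝ) (hfmeas : Measurable f) (hfnonneg : ∀ x, 0 ≤ f x)
    (hf : P.map W = volume.withDensity (fun x => ENNReal.ofReal (f x))) :
    -- every expectation, infimum, supremum and integral below is well defined and finite
    (∀ (g : ℕ) (V : Type) [Fintype V] [Nonempty V], ∀ G ∈ regularGirthFamily V g r,
      Integrable (fun w => GreedyMatching.weight G w / (Fintype.card V : ℝ))
        (GreedyMatching.weightLaw G (P.map W))) ∧
    (∀ g : ℕ, (GreedyMatching.ratios g r (P.map W)).Nonempty ∧
      BddBelow (GreedyMatching.ratios g r (P.map W)) ∧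
      BddAbove (GreedyMatching.ratios g r (P.map W))) ∧
    IntegrableOn (fun x : ℝ => x * ((r : ℝ) - 1 - ((r : ℝ) - 2) * F x) ^
      (-(2 * ((r : ℝ) - 1) / ((r : ℝ) - 2))) * f x) (Set.Ioi 0) ∧
    -- the two limits
    Tendsto (fun g : ℕ => sInf (GreedyMatching.ratios g r (P.map W))) atTop
      (𝓝 ((r : ℝ) / 2 * ∫ x in Set.Ioi (0 : ℝ),
        x * ((r : ℝ) - 1 - ((r : ℝ) - 2) * F x) ^
          (-(2 * ((r : ℝ) - 1) / ((r : ℝ) - 2))) * f x)) ∧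
    Tendsto (fun g : ℕ => sSup (GreedyMatching.ratios g r (P.map W))) atTop
      (𝓝 ((r : ℝ) / 2 * ∫ x in Set.Ioi (0 : ℝ),
        x * ((r : ℝ) - 1 - ((r : ℝ) - 2) * F x) ^
          (-(2 * ((r : ℝ) - 1) / ((r : ℝ) - 2))) * f x)) := by
  
  have hWm : AEMeasurable W P := hWint.aemeasurable
  -- `m` is the number of edges leading onwards from a vertex entered along an edge.
  obtain ⟨m, rfl⟩ : ∃ m, r = m + 1 := ⟨r - 1, by omega⟩
  have hm : 2 ≤ m := by omega
  set μ := P.map W with hμdef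
  have : IsProbabilityMeasure μ := Measure.isProbabilityMeasure_map hWm
  have : NullSingletonClass μ := ⟨fun x => by
    rw [hf]
    exact withDensity_absolutelyContinuous _ _ (measure_singleton x)⟩
  have hFcdf : F = ProbabilityTheory.cdf μ := by
    ext x
    rw [hF, ProbabilityTheory.cdf_eq_real, hμdef, map_measureReal_apply_of_aemeasurable hWm
      measurableSet_Iic]
    rfl
  have hμ : Integrable (fun x => x) μ :=
    (integrable_map_measure aestronglyMeasurable_id hWm).2 hWint
  have hnonneg : ∀ᵐ x ∂μ, 0 ≤ x := (ae_map_iff hWm measurableSet_Ici).2 hWnonneg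
  have hfmeas' : Measurable fun x => ENNReal.ofReal (f x) := hfmeas.ennreal_ofReal
  have hfun : (fun x : ℝ => x * (((m + 1 : ℕ) : ℝ) - 1 - (((m + 1 : ℕ) : ℝ) - 2) * F x) ^
      (-(2 * (((m + 1 : ℕ) : ℝ) - 1) / (((m + 1 : ℕ) : ℝ) - 2))) * f x) =
      fun x => (ENNReal.ofReal (f x)).toReal •
        (x * GreedyMatching.freeProbLimit m (ProbabilityTheory.cdf μ x) ^ 2) := by
    ext x
    rw [GreedyMatching.freeProbLimit_sq hm (ProbabilityTheory.cdf_le_one μ x), hFcdf,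
      ENNReal.toReal_ofReal (hfnonneg x), smul_eq_mul, mul_comm (f x)]
    push_cast
    rw [add_sub_cancel_right, show (m : ℝ) + 1 - 2 = m - 1 by ring]
  have hval : ∫ x in Set.Ioi (0 : ℝ), x * (((m + 1 : ℕ) : ℝ) - 1 - (((m + 1 : ℕ) : ℝ) - 2) * F x) ^
      (-(2 * (((m + 1 : ℕ) : ℝ) - 1) / (((m + 1 : ℕ) : ℝ) - 2))) * f x =
      ∫ y, y * GreedyMatching.freeProbLimit m (ProbabilityTheory.cdf μ y) ^ 2 ∂μ := by
    rw [hfun, ← setIntegral_withDensity_eq_setIntegral_toReal_smul hfmeas'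
      (Eventually.of_forall fun x => ENNReal.ofReal_lt_top) _ measurableSet_Ioi, ← hf]
    -- Off the positive half-line the weight is almost surely 0, and with it the factor `x`.
    refine setIntegral_eq_integral_of_ae_compl_eq_zero ?_
    filter_upwards [hnonneg] with x hx hx'
    rw [le_antisymm (not_lt.1 hx') hx, zero_mul]
  have hint := GreedyMatching.integrable_mul_freeProbLimit hm hμ
  have hlim := GreedyMatching.tendsto_integral_mul_freeProb hm hμ
  have h2k : Tendsto (fun k : ℕ => 2 * k) atTop atTop := tendsto_id.const_mul_atTop' two_pos
  rw [hval]
  refine ⟨fun g V _ _ G _ => GreedyMatching.integrable_weight hμ, fun g =>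
    ⟨GreedyMatching.ratios_nonempty g _ μ, ?_, ?_⟩, ?_, GreedyMatching.tendsto_sInf_sSup
      (fun g => GreedyMatching.ratios_nonempty g _ μ)
      -- Lower bounds come from the odd depths `2 * k + 1`, upper bounds from the even depths `2 *
      -- k`; both are subsequences of one convergent sequence.
      ((hlim.comp ((tendsto_add_atTop_nat 1).comp h2k)).const_mul _)
      ((hlim.comp h2k).const_mul _) (N := fun k => 4 * k + 6)
      fun k g hg => GreedyMatching.ratios_subset_Icc g k hg hμ hnonneg⟩
  · exact bddBelow_Icc.mono (GreedyMatching.ratios_subset_Icc_zero g _ hμ hnonneg)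
  · exact bddAbove_Icc.mono (GreedyMatching.ratios_subset_Icc_zero g _ hμ hnonneg)
  · rw [hfun, IntegrableOn]
    have hint' : Integrable (fun y => y * GreedyMatching.freeProbLimit m
        (ProbabilityTheory.cdf μ y) ^ 2) (volume.withDensity fun x => ENNReal.ofReal (f x)) := by
      rwa [← hf]
    exact ((integrable_withDensity_iff_integrable_smul' hfmeas'
      (Eventually.of_forall fun x => ENNReal.ofReal_lt_top)).1 hint').restrict
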